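/- Conventions. Fix $N\ge 2$. A plabic graph is a finite planar graph embedded in a closed disk (loops and multiple edges allowed) whose interior vertices are colored black or white and which has $N$ boundary vertices on the boundary circle, each of degree $1$, labeled $1,\dots,N$ clockwise; labels are read modulo $N$. It is assumed that every connected component contains a boundary vertex. A strand is a path that makes a sharp right turn at each black vertex and a sharp left turn at each white vertex; the strand permutation $\pi_G$ sends $i$ to $j$ if the strand starting at the boundary vertex $i$ terminates at the boundary vertex $j$. $G$ is reduced if it has the minimal number of faces among all plabic graphs with the same strand permutation, and trivalent if every interior vertex has degree $3$. A face is interior if it is not adjacent to the boundary of the disk. The planar dual $Q_G$ is the directed graph whose vertices are the interior faces of $G$ and which has, for every edge $e$ of $G$ with endpoints of different colors and with interior faces on both sides, one arrow across $e$ between the two faces adjacent to $e$, directed so that the white endpoint of $e$ is on the left as one moves along the arrow. $G$ is simple if $Q_G$ has no directed cycles of length $1$ or $2$. Adding a bridge between the boundary vertices $h$ and $h+1$ (modulo $N$) means: subdivide the edges of $G$ ending at the boundary vertices $h$ and $h+1$ by new vertices $u$ and $v$ next to the boundary, and join $u$ and $v$ by a new edge running along the boundary arc from $h$ to $h+1$.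 The bridge is black at $h$, white at $h+1$ if $u$ is black and $v$ is white, and white at $h$, black at $h+1$ if $u$ is white and $v$ is black. For a word $\mathbf w=(i_1,\dots,i_m)$, $m\ge 0$, in the alphabet $\{-1,\dots,-N\}\sqcup\{1,\dots,N\}$ and a permutation $\pi\in S_N$ without fixed points, let $G(\pi)$ be a reduced trivalent plabic graph with strand permutation $\pi$. The affine plabic fence $G(\mathbf w,\pi)$ is obtained from $G(\pi)$ by adding, successively for $j=m,m-1,\dots,1$, a bridge between the boundary vertices $h=|i_j|$ and $h+1$, black at $h$ and white at $h+1$ if $i_j>0$, and white at $h$ and black at $h+1$ if $i_j<0$. Proposition. For every $N\ge2$, every $m\ge0$, every word $\mathbf w\in\{\pm1,\dots,\pm N\}^m$, every permutation $\pi\in S_N$ without fixed points, and every choice of a reduced trivalent plabic graph $G(\pi)$ with strand permutation $\pi$, the affine plabic fence $G(\mathbf w,\pi)$ is simple; that is, its planar dual $Q_{G(\mathbf w,\pi)}$ has no loops and no directed $2$-cycles. -/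

import Mathlib

/-!  Plabic graphs in a disk are encoded by rotation systems on half-edges ("darts").
The base of a dart is the vertex it emanates from.  Boundary vertices are labelled clockwise by
`ZMod N`; the label `i ∈ {1, …, N}` is the class of `i`. -/

/-- The cycles (orbits, fixed points included) of a permutation. -/
abbrev CyclesOf {A : Type} (f : Equiv.Perm A) : Type :=
  Quotient (Equiv.Perm.SameCycle.setoid f)

/-- A graph with coloured interior vertices, with a cyclic order of the darts at each vertex, and
with `N` boundary vertices of degree one. The interior vertices are the cycles of `next` that
contain no boundary dart. -/
structure DiskMap (N : ℕ) where
  /-- the half-edges -/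
  Dart : Type
  finite_dart : Finite Dart
  /-- the other half of the same edge -/
  other : Equiv.Perm Dart
  /-- the next dart, in clockwise order, with the same base -/
  next : Equiv.Perm Dart
  /-- the unique dart based at each boundary vertex -/
  bdry : ZMod N ↪ Dart
  /-- whether the base of a dart is black (otherwise white); of no significance for the darts
  based at boundary vertices -/
  isBlack : Dart → Bool
  other_other : ∀ d, other (other d) = d
  other_ne : ∀ d, other d ≠ d
  next_bdry : ∀ i, next (bdry i) = bdry i
  isBlack_next : ∀ d, isBlack (next d) = isBlack d

namespace DiskMap

variable {N : ℕ}

/-- Walking along the boundary of the face to the left of a dart. One traverses the dart; if its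
far end is an interior vertex one makes the sharpest left turn there; if its far end is the
boundary vertex `i`, one follows the boundary circle counterclockwise to the boundary vertex
`i - 1` and continues along the dart based there. -/
noncomputable def faceNext (G : DiskMap N) : Equiv.Perm G.Dart :=
  G.next * Equiv.Perm.viaEmbedding (Equiv.subRight (1 : ZMod N)) G.bdry * G.other

/-- The faces into which the graph cuts the disk. -/
abbrev Face (G : DiskMap N) : Type := CyclesOf G.faceNext

/-- The face to the left of a dart. -/
noncomputable def leftFace (G : DiskMap N) (d : G.Dart) : G.Face := Quotient.mk _ d

/-- A face is interior if it is not adjacent to the boundary of the disk. The face adjacent to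
the boundary arc from `i` clockwise to `i + 1` is the one to the left of `bdry i`. -/
def IsInteriorFace (G : DiskMap N) (F : G.Face) : Prop := ∀ i, F ≠ G.leftFace (G.bdry i)

/-- The interior faces: the vertices of the planar dual. -/
def InteriorFace (G : DiskMap N) : Type := {F : G.Face // G.IsInteriorFace F}

/-- The planar dual directed graph. An arrow `F ⟶ F'` is an edge with a white and a black
endpoint, given by its dart `d` leaving the white endpoint, that has `F` on its right and `F'` on
its left. (So the white endpoint is on the left as one crosses the edge from `F` to `F'`.) -/
instance dualQuiver (G : DiskMap N) : Quiver G.InteriorFace where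
  Hom F F' := {d : G.Dart // G.isBlack d = false ∧ G.isBlack (G.other d) = true ∧
    G.leftFace (G.other d) = F.1 ∧ G.leftFace d = F'.1}

/-- The planar dual has no directed cycles of length one or two. -/
def IsSimple (G : DiskMap N) : Prop :=
  (∀ F : G.InteriorFace, IsEmpty (F ⟶ F)) ∧
  (∀ F F' : G.InteriorFace, Nonempty (F ⟶ F') → IsEmpty (F' ⟶ F))

/-- Each interior vertex has degree three. -/
def IsTrivalent (G : DiskMap N) : Prop :=
  ∀ d, d ∉ Set.range G.bdry → G.next d ≠ d ∧ G.next (G.next (G.next d)) = d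

/-- One step of a strand: having traversed `d`, make the sharpest right turn at a black vertex
and the sharpest left turn at a white vertex. -/
def strandStep (G : DiskMap N) (d : G.Dart) : G.Dart :=
  if G.isBlack (G.other d) then G.next.symm (G.other d) else G.next (G.other d)

/-- The strand that starts at the boundary vertex `i` terminates at the boundary vertex `j`. -/
def StrandFromTo (G : DiskMap N) (i j : ZMod N) : Prop :=
  ∃ n : ℕ, (∀ m < n, G.other (G.strandStep^[m] (G.bdry i)) ∉ Set.range G.bdry) ∧
    G.other (G.strandStep^[n] (G.bdry i)) = G.bdry j

/-- `π` is the strand permutation. -/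
def HasStrandPerm (G : DiskMap N) (π : Equiv.Perm (ZMod N)) : Prop :=
  ∀ i, G.StrandFromTo i (π i)

/-- Each connected component of the graph meets the boundary of the disk: a set of darts that is
a union of components and contains all boundary darts is everything. -/
def MeetsBoundary (G : DiskMap N) : Prop :=
  ∀ S : Set G.Dart, (∀ i, G.bdry i ∈ S) → (∀ d, G.next d ∈ S ↔ d ∈ S) →
    (∀ d, G.other d ∈ S ↔ d ∈ S) → ∀ d, d ∈ S

/-- Euler's formula `V - E + F = 1` for the cell decomposition of a disk given by the graph
together with the boundary circle, which contributes `N` further edges. -/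
def IsPlanar (G : DiskMap N) : Prop :=
  Nat.card (CyclesOf G.next) + Nat.card G.Face = Nat.card (CyclesOf G.other) + N + 1

/-- The darts added with a bridge: for each of its two ends (`L` on the edge of the boundary
vertex `h`, and `R` on the edge of the boundary vertex `h + 1`) the new dart `bd` based at the
boundary vertex, and the darts `out` towards the boundary and `br` along the bridge, both based at
the end of the bridge. -/
inductive BridgeDart : Type
  | bdL | outL | brL | bdR | outR | brR
  deriving DecidableEq

namespace BridgeDart

/-- Pairing of the new darts into edges. -/
def other : BridgeDart → BridgeDart
  | bdL => outL
  | outL => bdL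
  | bdR => outR
  | outR => bdR
  | brL => brR
  | brR => brL

theorem other_other (d : BridgeDart) : other (other d) = d := by cases d <;> rfl

theorem other_ne (d : BridgeDart) : other d ≠ d := by cases d <;> decide

def otherPerm : Equiv.Perm BridgeDart := ⟨other, other, other_other, other_other⟩

instance : Finite BridgeDart :=
  Finite.of_surjective (fun i : Fin 6 => match i with
    | 0 => bdL | 1 => outL | 2 => brL | 3 => bdR | 4 => outR | 5 => brR) <| by
  intro d
  cases d
  exacts [⟨0, rfl⟩, ⟨1, rfl⟩, ⟨2, rfl⟩, ⟨3, rfl⟩, ⟨4, rfl⟩, ⟨5, rfl⟩]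

end BridgeDart

open BridgeDart

section Bridge

open scoped Classical in
/-- Rotation after adding a bridge. The former boundary darts `bdry h` and `bdry (h + 1)` are now
based at the left and right ends of the bridge and lead away from the boundary. Clockwise around
the left end one meets `out`, `br`, `bdry h`; clockwise around the right end one meets
`out`, `bdry (h + 1)`, `br`. -/
noncomputable def bridgeNext (G : DiskMap N) (h : ZMod N) : Equiv.Perm (G.Dart ⊕ BridgeDart) :=
  Equiv.sumCongr G.next (Equiv.refl _) *
    (List.formPerm [Sum.inr outL, Sum.inr brL, Sum.inl (G.bdry h)] *
      List.formPerm [Sum.inr outR, Sum.inl (G.bdry (h + 1)), Sum.inr brR])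

/-- Boundary darts after adding a bridge. -/
def bridgeBdry (G : DiskMap N) (h i : ZMod N) : G.Dart ⊕ BridgeDart :=
  if i = h then Sum.inr bdL else if i = h + 1 then Sum.inr bdR else Sum.inl (G.bdry i)

open scoped Classical in
/-- Colours after adding a bridge whose left end is black if and only if `c` is true and whose
right end has the opposite colour. -/
noncomputable def bridgeBlack (G : DiskMap N) (h : ZMod N) (c : Bool) :
    G.Dart ⊕ BridgeDart → Bool
  | Sum.inl d => if d = G.bdry h then c else if d = G.bdry (h + 1) then !c else G.isBlack d
  | Sum.inr bdL => c
  | Sum.inr outL => c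
  | Sum.inr brL => c
  | Sum.inr bdR => !c
  | Sum.inr outR => !c
  | Sum.inr brR => !c

theorem succ_ne (hN : 2 ≤ N) (h : ZMod N) : h + 1 ≠ h := by
  have : Fact (1 < N) := ⟨hN⟩
  simp


section Next

variable (G : DiskMap N) (h : ZMod N)

theorem bridgeNext_bdL : G.bridgeNext h (Sum.inr bdL) = Sum.inr bdL := by
  simp [bridgeNext, List.formPerm_cons_cons, Equiv.swap_apply_def]

theorem bridgeNext_bdR : G.bridgeNext h (Sum.inr bdR) = Sum.inr bdR := by
  simp [bridgeNext, List.formPerm_cons_cons, Equiv.swap_apply_def]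

theorem bridgeNext_outL : G.bridgeNext h (Sum.inr outL) = Sum.inr brL := by
  simp [bridgeNext, List.formPerm_cons_cons, Equiv.swap_apply_def]

theorem bridgeNext_brL : G.bridgeNext h (Sum.inr brL) = Sum.inl (G.bdry h) := by
  simp [bridgeNext, List.formPerm_cons_cons, Equiv.swap_apply_def, G.next_bdry]

theorem bridgeNext_outR (hN : 2 ≤ N) :
    G.bridgeNext h (Sum.inr outR) = Sum.inl (G.bdry (h + 1)) := by
  have := succ_ne hN h
  simp [bridgeNext, List.formPerm_cons_cons, Equiv.swap_apply_def, G.next_bdry, this]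

theorem bridgeNext_brR : G.bridgeNext h (Sum.inr brR) = Sum.inr outR := by
  simp [bridgeNext, List.formPerm_cons_cons, Equiv.swap_apply_def]

theorem bridgeNext_left (hN : 2 ≤ N) :
    G.bridgeNext h (Sum.inl (G.bdry h)) = Sum.inr outL := by
  have := (succ_ne hN h).symm
  simp [bridgeNext, List.formPerm_cons_cons, Equiv.swap_apply_def, this]

theorem bridgeNext_right : G.bridgeNext h (Sum.inl (G.bdry (h + 1))) = Sum.inr brR := by
  simp [bridgeNext, List.formPerm_cons_cons, Equiv.swap_apply_def]

theorem bridgeNext_inl {d : G.Dart} (h1 : d ≠ G.bdry h) (h2 : d ≠ G.bdry (h + 1)) :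
    G.bridgeNext h (Sum.inl d) = Sum.inl (G.next d) := by
  simp [bridgeNext, List.formPerm_cons_cons, Equiv.swap_apply_def, h1, h2]

end Next


theorem bridgeBdry_injective (G : DiskMap N) (h : ZMod N) :
    Function.Injective (G.bridgeBdry h) := by
  intro i j hij
  unfold bridgeBdry at hij
  split_ifs at hij <;> simp_all

/-- Adding, next to the boundary of the disk, a bridge between the boundary vertices `h` and
`h + 1`: each of the two edges ending at these vertices is subdivided by a new vertex, and the two
new vertices are joined by an edge. The one at `h` is black if and only if `c` is true; the other
has the opposite colour. -/
noncomputable def addBridge (hN : 2 ≤ N) (G : DiskMap N) (h : ZMod N) (c : Bool) : DiskMap N where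
  Dart := G.Dart ⊕ BridgeDart
  finite_dart := haveI := G.finite_dart; inferInstance
  other := Equiv.sumCongr G.other otherPerm
  next := G.bridgeNext h
  bdry := ⟨G.bridgeBdry h, G.bridgeBdry_injective h⟩
  isBlack := G.bridgeBlack h c
  other_other := by
    rintro (d | d)
    · simp [G.other_other]
    · cases d <;> rfl
  other_ne := by
    rintro (d | d)
    · simp [G.other_ne]
    · cases d <;> simp [otherPerm, BridgeDart.other]
  next_bdry := by
    intro i
    change G.bridgeNext h (G.bridgeBdry h i) = G.bridgeBdry h i
    unfold bridgeBdry
    split_ifs with h1 h2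
    · exact G.bridgeNext_bdL h
    · exact G.bridgeNext_bdR h
    · rw [G.bridgeNext_inl h (by simpa using h1) (by simpa using h2), G.next_bdry]
  isBlack_next := by
    have hne := succ_ne hN h
    rintro (d | d)
    · by_cases h1 : d = G.bdry h
      · subst h1
        rw [G.bridgeNext_left h hN]; simp [bridgeBlack]
      by_cases h2 : d = G.bdry (h + 1)
      · subst h2
        rw [G.bridgeNext_right h]; simp [bridgeBlack, hne]
      · rw [G.bridgeNext_inl h h1 h2]
        have h3 : G.next d ≠ G.bdry h := fun e => h1 (G.next.injective (e.trans (G.next_bdry h).symm))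
        have h4 : G.next d ≠ G.bdry (h + 1) :=
          fun e => h2 (G.next.injective (e.trans (G.next_bdry (h + 1)).symm))
        simp [bridgeBlack, h1, h2, h3, h4, G.isBlack_next]
    · cases d
      · rw [bridgeNext_bdL]
      · rw [bridgeNext_outL]; simp [bridgeBlack]
      · rw [bridgeNext_brL]; simp [bridgeBlack]
      · rw [bridgeNext_bdR]
      · rw [bridgeNext_outR G h hN]; simp [bridgeBlack, hne]
      · rw [bridgeNext_brR]; simp [bridgeBlack]

theorem MeetsBoundary.addBridge (hN : 2 ≤ N) {G : DiskMap N} (hG : G.MeetsBoundary) (h : ZMod N)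
    (c : Bool) : (G.addBridge hN h c).MeetsBoundary := by
  intro S hb hn ho
  have hne := succ_ne hN h
  have bL : (Sum.inr bdL : G.Dart ⊕ BridgeDart) ∈ S := by
    have : G.bridgeBdry h h ∈ S := hb h
    simpa [bridgeBdry] using this
  have bR : (Sum.inr bdR : G.Dart ⊕ BridgeDart) ∈ S := by
    have : G.bridgeBdry h (h + 1) ∈ S := hb (h + 1)
    simpa [bridgeBdry, hne] using this
  have hn' : ∀ d : G.Dart ⊕ BridgeDart, G.bridgeNext h d ∈ S ↔ d ∈ S := hn
  have oL : (Sum.inr outL : G.Dart ⊕ BridgeDart) ∈ S := (ho (Sum.inr bdL)).2 bL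
  have oR : (Sum.inr outR : G.Dart ⊕ BridgeDart) ∈ S := (ho (Sum.inr bdR)).2 bR
  have rL : (Sum.inr brL : G.Dart ⊕ BridgeDart) ∈ S := by
    rw [← G.bridgeNext_outL h]; exact (hn' _).2 oL
  have xL : (Sum.inl (G.bdry h) : G.Dart ⊕ BridgeDart) ∈ S := by
    rw [← G.bridgeNext_brL h]; exact (hn' _).2 rL
  have xR : (Sum.inl (G.bdry (h + 1)) : G.Dart ⊕ BridgeDart) ∈ S := by
    rw [← G.bridgeNext_outR h hN]; exact (hn' _).2 oR
  have rR : (Sum.inr brR : G.Dart ⊕ BridgeDart) ∈ S := by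
    rw [← G.bridgeNext_right h]; exact (hn' _).2 xR
  have key : ∀ d : G.Dart, (Sum.inl d : G.Dart ⊕ BridgeDart) ∈ S := by
    refine hG {d | (Sum.inl d : G.Dart ⊕ BridgeDart) ∈ S} ?_ ?_ ?_
    · intro i
      by_cases h1 : i = h
      · subst h1; exact xL
      by_cases h2 : i = h + 1
      · subst h2; exact xR
      have : G.bridgeBdry h i ∈ S := hb i
      simpa [bridgeBdry, h1, h2] using this
    · intro d
      by_cases h1 : d = G.bdry h
      · subst h1; rw [G.next_bdry]
      by_cases h2 : d = G.bdry (h + 1)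
      · subst h2; rw [G.next_bdry]
      have := hn' (Sum.inl d)
      rwa [G.bridgeNext_inl h h1 h2] at this
    · intro d
      exact ho (Sum.inl d)
  rintro (d | d)
  · exact key d
  · cases d <;> assumption

/-- Counting the cycles of a permutation by means of a complete invariant. -/
theorem card_cyclesOf {A T : Type} (f : Equiv.Perm A) (p : A → T) (s : T → A)
    (hp : ∀ a, p (f a) = p a) (hps : ∀ t, p (s t) = t)
    (hs : ∀ a, Equiv.Perm.SameCycle f a (s (p a))) :
    Nat.card (CyclesOf f) = Nat.card T := by
  have hp' : ∀ a b, Equiv.Perm.SameCycle f a b → p a = p b := by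
    have hz : ∀ (n : ℤ) (a : A), p ((f ^ n) a) = p a := by
      intro n
      induction n with
      | zero => simp
      | succ n ih => intro a; rw [zpow_add_one, Equiv.Perm.mul_apply, ih, hp]
      | pred n ih =>
        intro a
        rw [zpow_sub_one, Equiv.Perm.mul_apply, ih]
        have e : f (f⁻¹ a) = a := f.apply_symm_apply a
        conv_rhs => rw [← e, hp]
    rintro a b ⟨n, rfl⟩
    exact (hz n a).symm
  refine Nat.card_congr
    { toFun := Quotient.lift p hp'
      invFun := fun t => Quotient.mk _ (s t)
      left_inv := ?_
      right_inv := hps }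
  intro q
  induction q using Quotient.inductionOn with
  | h a => exact Quotient.sound (hs a).symm

/-- A map that respects the steps of two permutations respects their cycles. -/
theorem sameCycle_map {A B : Type} {f : Equiv.Perm A} {g : Equiv.Perm B} (j : A → B)
    (hj : ∀ a, Equiv.Perm.SameCycle g (j a) (j (f a))) {a b : A}
    (hab : Equiv.Perm.SameCycle f a b) : Equiv.Perm.SameCycle g (j a) (j b) := by
  have hz : ∀ (n : ℤ) (a : A), Equiv.Perm.SameCycle g (j a) (j ((f ^ n) a)) := by
    intro n
    induction n with
    | zero => intro a; exact Equiv.Perm.SameCycle.refl _ _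
    | succ n ih =>
      intro a
      rw [zpow_add_one, Equiv.Perm.mul_apply]
      exact (hj a).trans (ih (f a))
    | pred n ih =>
      intro a
      rw [zpow_sub_one, Equiv.Perm.mul_apply]
      have := hj (f⁻¹ a)
      have e : f (f⁻¹ a) = a := f.apply_symm_apply a
      rw [e] at this
      exact this.symm.trans (ih _)
  obtain ⟨n, rfl⟩ := hab
  exact hz n a

theorem sameCycle_out {A B : Type} {f : Equiv.Perm A} {g : Equiv.Perm B} (j : A → B)
    (hj : ∀ a, Equiv.Perm.SameCycle g (j a) (j (f a))) (a : A) :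
    Equiv.Perm.SameCycle g (j a) (j (Quotient.mk (Equiv.Perm.SameCycle.setoid f) a).out) :=
  sameCycle_map j hj (Equiv.Perm.SameCycle.symm
    (Quotient.exact (Quotient.out_eq (Quotient.mk (Equiv.Perm.SameCycle.setoid f) a))))

theorem sameCycle_step {A : Type} {f : Equiv.Perm A} {a b : A} (h : f a = b) :
    Equiv.Perm.SameCycle f a b := ⟨1, by simpa using h⟩

theorem mk_apply_eq {A : Type} (f : Equiv.Perm A) (a : A) :
    (Quotient.mk _ (f a) : CyclesOf f) = Quotient.mk _ a :=
  Quotient.sound (sameCycle_step rfl).symm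

instance finite_cyclesOf {A : Type} [Finite A] (f : Equiv.Perm A) : Finite (CyclesOf f) :=
  inferInstance

theorem card_next_addBridge (hN : 2 ≤ N) (G : DiskMap N) (h : ZMod N) (c : Bool) :
    Nat.card (CyclesOf (G.addBridge hN h c).next) = Nat.card (CyclesOf G.next) + 2 := by
  have := G.finite_dart
  have hfin : Finite (CyclesOf G.next) := finite_cyclesOf G.next
  have hj : ∀ d : G.Dart, Equiv.Perm.SameCycle (G.bridgeNext h) (Sum.inl d)
      (Sum.inl (G.next d)) := by
    intro d
    by_cases h1 : d = G.bdry h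
    · subst h1; rw [G.next_bdry]
    by_cases h2 : d = G.bdry (h + 1)
    · subst h2; rw [G.next_bdry]
    exact sameCycle_step (G.bridgeNext_inl h h1 h2)
  let q : G.Dart → CyclesOf G.next := Quotient.mk _
  let p : G.Dart ⊕ BridgeDart → CyclesOf G.next ⊕ Bool
    | Sum.inl d => Sum.inl (q d)
    | Sum.inr bdL => Sum.inr true
    | Sum.inr outL => Sum.inl (q (G.bdry h))
    | Sum.inr brL => Sum.inl (q (G.bdry h))
    | Sum.inr bdR => Sum.inr false
    | Sum.inr outR => Sum.inl (q (G.bdry (h + 1)))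
    | Sum.inr brR => Sum.inl (q (G.bdry (h + 1)))
  let s : CyclesOf G.next ⊕ Bool → G.Dart ⊕ BridgeDart
    | Sum.inl t => Sum.inl t.out
    | Sum.inr true => Sum.inr bdL
    | Sum.inr false => Sum.inr bdR
  have key := card_cyclesOf (G.bridgeNext h) p s ?_ ?_ ?_
  · change Nat.card (CyclesOf (G.bridgeNext h)) = _
    rw [key, Nat.card_sum]; simp
  · rintro (d | d)
    · by_cases h1 : d = G.bdry h
      · subst h1; rw [G.bridgeNext_left h hN]
      by_cases h2 : d = G.bdry (h + 1)
      · subst h2; rw [G.bridgeNext_right h]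
      rw [G.bridgeNext_inl h h1 h2]
      exact congrArg Sum.inl (mk_apply_eq _ _)
    · cases d
      · rw [bridgeNext_bdL]
      · rw [bridgeNext_outL]
      · rw [bridgeNext_brL]
      · rw [bridgeNext_bdR]
      · rw [bridgeNext_outR G h hN]
      · rw [bridgeNext_brR]
  · rintro (t | t)
    · exact congrArg Sum.inl (Quotient.out_eq t)
    · cases t <;> rfl
  · rintro (d | d)
    · exact sameCycle_out Sum.inl hj d
    · cases d
      · exact Equiv.Perm.SameCycle.refl _ _
      · exact (sameCycle_step (G.bridgeNext_outL h)).trans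
          ((sameCycle_step (G.bridgeNext_brL h)).trans (sameCycle_out Sum.inl hj _))
      · exact (sameCycle_step (G.bridgeNext_brL h)).trans (sameCycle_out Sum.inl hj _)
      · exact Equiv.Perm.SameCycle.refl _ _
      · exact (sameCycle_step (G.bridgeNext_outR h hN)).trans (sameCycle_out Sum.inl hj _)
      · exact (sameCycle_step (G.bridgeNext_brR h)).trans
          ((sameCycle_step (G.bridgeNext_outR h hN)).trans (sameCycle_out Sum.inl hj _))

theorem card_other_addBridge (hN : 2 ≤ N) (G : DiskMap N) (h : ZMod N) (c : Bool) :
    Nat.card (CyclesOf (G.addBridge hN h c).other) = Nat.card (CyclesOf G.other) + 3 := by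
  have := G.finite_dart
  have hfin : Finite (CyclesOf G.other) := finite_cyclesOf G.other
  have hj : ∀ d : G.Dart, Equiv.Perm.SameCycle (Equiv.sumCongr G.other otherPerm) (Sum.inl d)
      (Sum.inl (G.other d)) := fun d => sameCycle_step rfl
  let q : G.Dart → CyclesOf G.other := Quotient.mk _
  let p : G.Dart ⊕ BridgeDart → CyclesOf G.other ⊕ Fin 3
    | Sum.inl d => Sum.inl (q d)
    | Sum.inr bdL => Sum.inr 0
    | Sum.inr outL => Sum.inr 0
    | Sum.inr brL => Sum.inr 1
    | Sum.inr bdR => Sum.inr 2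
    | Sum.inr outR => Sum.inr 2
    | Sum.inr brR => Sum.inr 1
  let s : CyclesOf G.other ⊕ Fin 3 → G.Dart ⊕ BridgeDart
    | Sum.inl t => Sum.inl t.out
    | Sum.inr 0 => Sum.inr bdL
    | Sum.inr 1 => Sum.inr brL
    | Sum.inr 2 => Sum.inr bdR
  have key := card_cyclesOf (Equiv.sumCongr G.other otherPerm) p s ?_ ?_ ?_
  · change Nat.card (CyclesOf (Equiv.sumCongr G.other otherPerm)) = _
    rw [key, Nat.card_sum]; simp
  · rintro (d | d)
    · exact congrArg Sum.inl (mk_apply_eq _ _)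
    · cases d <;> rfl
  · rintro (t | t)
    · exact congrArg Sum.inl (Quotient.out_eq t)
    · fin_cases t <;> rfl
  · rintro (d | d)
    · exact sameCycle_out Sum.inl hj d
    · cases d
      · exact Equiv.Perm.SameCycle.refl _ _
      · exact sameCycle_step rfl
      · exact Equiv.Perm.SameCycle.refl _ _
      · exact Equiv.Perm.SameCycle.refl _ _
      · exact sameCycle_step rfl
      · exact sameCycle_step rfl

/-- At the far end of the traversed dart one continues on the boundary circle. -/
theorem faceNext_of_bdry (G : DiskMap N) {d : G.Dart} {i : ZMod N} (hd : G.other d = G.bdry i) :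
    G.faceNext d = G.bdry (i - 1) := by
  simp [faceNext, hd, Equiv.Perm.viaEmbedding_apply, G.next_bdry]

/-- At the far end of the traversed dart one turns left. -/
theorem faceNext_of_not_bdry (G : DiskMap N) {d : G.Dart}
    (hd : G.other d ∉ Set.range G.bdry) : G.faceNext d = G.next (G.other d) := by
  simp [faceNext, Equiv.Perm.viaEmbedding_apply_of_notMem _ _ _ hd]


theorem faceNext_of_eq (G : DiskMap N) {d e : G.Dart} (hd : G.other d = e)
    (he : e ∉ Set.range G.bdry) : G.faceNext d = G.next e := by
  subst hd; exact G.faceNext_of_not_bdry he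

theorem card_face_addBridge (hN : 2 ≤ N) (G : DiskMap N) (h : ZMod N) (c : Bool) :
    Nat.card (G.addBridge hN h c).Face = Nat.card G.Face + 1 := by
  have := G.finite_dart
  have hfin : Finite G.Face := finite_cyclesOf G.faceNext
  have hne := succ_ne hN h
  let G' := G.addBridge hN h c
  -- the boundary darts of the new graph
  have bL : G'.bdry h = Sum.inr bdL := by
    change G.bridgeBdry h h = _; simp [bridgeBdry]
  have bR : G'.bdry (h + 1) = Sum.inr bdR := by
    change G.bridgeBdry h (h + 1) = _; simp [bridgeBdry, hne]
  have bO : ∀ i, i ≠ h → i ≠ h + 1 → G'.bdry i = Sum.inl (G.bdry i) := by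
    intro i h1 h2; change G.bridgeBdry h i = _; simp [bridgeBdry, h1, h2]
  have nb1 : ∀ b : BridgeDart, b ≠ bdL → b ≠ bdR →
      (Sum.inr b : G.Dart ⊕ BridgeDart) ∉ Set.range G'.bdry := by
    rintro b h1 h2 ⟨i, hi⟩
    change G.bridgeBdry h i = _ at hi
    unfold bridgeBdry at hi
    split_ifs at hi <;> simp_all
  have nb2 : ∀ d : G.Dart, d ∉ Set.range G.bdry →
      (Sum.inl d : G.Dart ⊕ BridgeDart) ∉ Set.range G'.bdry := by
    rintro d h1 ⟨i, hi⟩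
    change G.bridgeBdry h i = _ at hi
    unfold bridgeBdry at hi
    split_ifs at hi
    exact h1 ⟨i, Sum.inl.inj hi⟩
  have nb3 : (Sum.inl (G.bdry h) : G.Dart ⊕ BridgeDart) ∉ Set.range G'.bdry := by
    rintro ⟨i, hi⟩
    change G.bridgeBdry h i = _ at hi
    unfold bridgeBdry at hi
    split_ifs at hi with h1 h2
    exact h1 (G.bdry.injective (Sum.inl.inj hi))
  have nb4 : (Sum.inl (G.bdry (h + 1)) : G.Dart ⊕ BridgeDart) ∉ Set.range G'.bdry := by
    rintro ⟨i, hi⟩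
    change G.bridgeBdry h i = _ at hi
    unfold bridgeBdry at hi
    split_ifs at hi with h1 h2
    exact h2 (G.bdry.injective (Sum.inl.inj hi))
  -- the face walk of the new graph
  have fbdL : G'.faceNext (Sum.inr bdL) = Sum.inr brL :=
    (G'.faceNext_of_not_bdry (nb1 outL (by decide) (by decide))).trans (G.bridgeNext_outL h)
  have fbrL : G'.faceNext (Sum.inr brL) = Sum.inr outR :=
    (G'.faceNext_of_not_bdry (nb1 brR (by decide) (by decide))).trans (G.bridgeNext_brR h)
  have foutR : G'.faceNext (Sum.inr outR) = Sum.inr bdL := by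
    rw [G'.faceNext_of_bdry (i := h + 1) (d := Sum.inr outR) bR.symm, add_sub_cancel_right, bL]
  have fbdR : G'.faceNext (Sum.inr bdR) = Sum.inl (G.bdry (h + 1)) :=
    (G'.faceNext_of_not_bdry (nb1 outR (by decide) (by decide))).trans (G.bridgeNext_outR h hN)
  have fbrR : G'.faceNext (Sum.inr brR) = Sum.inl (G.bdry h) :=
    (G'.faceNext_of_not_bdry (nb1 brL (by decide) (by decide))).trans (G.bridgeNext_brL h)
  -- a walk step onto a boundary dart, where `bdry (h + 1)` may be preceded by the new dart
  have fstep : ∀ (d : G.Dart ⊕ BridgeDart) (i : ZMod N), i ≠ h + 1 → G'.other d = G'.bdry i →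
      G'.faceNext d = Sum.inl (G.bdry (i - 1)) ∨
        (G'.faceNext d = Sum.inr bdR ∧ i - 1 = h + 1) := by
    intro d i hi hd
    rw [G'.faceNext_of_bdry hd]
    by_cases h1 : i - 1 = h + 1
    · right; rw [h1]; exact ⟨bR, rfl⟩
    · left; exact bO _ (fun e => hi (by rw [← e]; ring)) h1
  have foutL := fstep (Sum.inr outL) h hne.symm bL.symm
  have finl : ∀ d : G.Dart,
      (G'.faceNext (Sum.inl d) = Sum.inl (G.faceNext d)) ∨
      (G'.faceNext (Sum.inl d) = Sum.inr bdR ∧ G.faceNext d = G.bdry (h + 1)) ∨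
      (G'.faceNext (Sum.inl d) = Sum.inr outL ∧ G.faceNext d = G.bdry (h - 1)) ∨
      (G'.faceNext (Sum.inl d) = Sum.inr brR ∧ G.faceNext d = G.bdry h) := by
    intro d
    by_cases hd : G.other d ∈ Set.range G.bdry
    · obtain ⟨i, hi⟩ := hd
      have hf := G.faceNext_of_bdry hi.symm
      have ho : G'.other (Sum.inl d) = Sum.inl (G.bdry i) := congrArg Sum.inl hi.symm
      by_cases h1 : i = h
      · subst h1
        right; right; left
        refine ⟨?_, hf⟩
        exact (G'.faceNext_of_eq ho nb3).trans (G.bridgeNext_left i hN)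
      by_cases h2 : i = h + 1
      · subst h2
        right; right; right
        refine ⟨?_, by simpa using hf⟩
        exact (G'.faceNext_of_eq ho nb4).trans (G.bridgeNext_right h)
      · rcases fstep (Sum.inl d) i h2 (ho.trans (bO i h1 h2).symm) with h3 | ⟨h3, h4⟩
        · left; rw [h3, hf]
        · right; left; exact ⟨h3, by rw [hf, h4]⟩
    · left
      have ho : G'.other (Sum.inl d) = Sum.inl (G.other d) := rfl
      rw [G.faceNext_of_not_bdry hd]
      exact (G'.faceNext_of_eq ho (nb2 _ hd)).trans
        (G.bridgeNext_inl h (fun e => hd ⟨_, e.symm⟩) (fun e => hd ⟨_, e.symm⟩))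
  let q : G.Dart → G.Face := Quotient.mk _
  have hq : ∀ d, q (G.faceNext d) = q d := mk_apply_eq G.faceNext
  let p : G.Dart ⊕ BridgeDart → G.Face ⊕ Unit
    | Sum.inl d => Sum.inl (q d)
    | Sum.inr bdL => Sum.inr ()
    | Sum.inr brL => Sum.inr ()
    | Sum.inr outR => Sum.inr ()
    | Sum.inr outL => Sum.inl (q (G.bdry (h - 1)))
    | Sum.inr brR => Sum.inl (q (G.bdry h))
    | Sum.inr bdR => Sum.inl (q (G.bdry (h + 1)))
  let s : G.Face ⊕ Unit → G.Dart ⊕ BridgeDart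
    | Sum.inl t => Sum.inl t.out
    | Sum.inr () => Sum.inr bdL
  have sbdR := sameCycle_step fbdR
  have sbrR := sameCycle_step fbrR
  have soutL : Equiv.Perm.SameCycle G'.faceNext (Sum.inr outL) (Sum.inl (G.bdry (h - 1))) := by
    rcases foutL with h1 | ⟨h1, h2⟩
    · exact sameCycle_step h1
    · rw [h2]; exact (sameCycle_step h1).trans sbdR
  have hj : ∀ d : G.Dart, Equiv.Perm.SameCycle G'.faceNext (Sum.inl d)
      (Sum.inl (G.faceNext d)) := by
    intro d
    rcases finl d with h1 | ⟨h1, h2⟩ | ⟨h1, h2⟩ | ⟨h1, h2⟩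
    · exact sameCycle_step h1
    · rw [h2]; exact (sameCycle_step h1).trans sbdR
    · rw [h2]; exact (sameCycle_step h1).trans soutL
    · rw [h2]; exact (sameCycle_step h1).trans sbrR
  have key := card_cyclesOf G'.faceNext p s ?_ ?_ ?_
  · change Nat.card (CyclesOf G'.faceNext) = _
    rw [key, Nat.card_sum]; simp
  · rintro (d | d)
    · have hd := hq d
      rcases finl d with h1 | ⟨h1, h2⟩ | ⟨h1, h2⟩ | ⟨h1, h2⟩
      · rw [h1]; exact congrArg Sum.inl hd
      · rw [h1]; rw [h2] at hd; exact congrArg Sum.inl hd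
      · rw [h1]; rw [h2] at hd; exact congrArg Sum.inl hd
      · rw [h1]; rw [h2] at hd; exact congrArg Sum.inl hd
    · cases d
      · rw [fbdL]
      · rcases foutL with h1 | ⟨h1, h2⟩
        · rw [h1]
        · rw [h1]; change Sum.inl (q _) = Sum.inl (q _); rw [h2]
      · rw [fbrL]
      · rw [fbdR]
      · rw [foutR]
      · rw [fbrR]
  · rintro (t | t)
    · exact congrArg Sum.inl (Quotient.out_eq t)
    · rfl
  · rintro (d | d)
    · exact sameCycle_out Sum.inl hj d
    · cases d
      · exact Equiv.Perm.SameCycle.refl _ _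
      · exact soutL.trans (sameCycle_out Sum.inl hj _)
      · exact (sameCycle_step fbrL).trans (sameCycle_step foutR)
      · exact sbdR.trans (sameCycle_out Sum.inl hj _)
      · exact sameCycle_step foutR
      · exact sbrR.trans (sameCycle_out Sum.inl hj _)

theorem IsPlanar.addBridge (hN : 2 ≤ N) {G : DiskMap N} (hG : G.IsPlanar) (h : ZMod N)
    (c : Bool) : (G.addBridge hN h c).IsPlanar := by
  unfold IsPlanar at hG ⊢
  rw [card_next_addBridge, card_other_addBridge, card_face_addBridge]
  omega

end Bridge

end DiskMap

/-- A plabic graph with `N` boundary vertices. -/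
structure PlabicGraph (N : ℕ) extends DiskMap N where
  meetsBoundary : toDiskMap.MeetsBoundary
  isPlanar : toDiskMap.IsPlanar

namespace PlabicGraph

variable {N : ℕ}

/-- A plabic graph is reduced if it has the minimal number of faces among all plabic graphs with
the same strand permutation. -/
def IsReduced (G : PlabicGraph N) : Prop :=
  ∀ H : PlabicGraph N, (∀ i j, H.StrandFromTo i j ↔ G.StrandFromTo i j) →
    Nat.card G.Face ≤ Nat.card H.Face

/-- Adding a bridge between the boundary vertices `h` and `h + 1`, black at `h` and white at
`h + 1` if `c` is true, and white at `h` and black at `h + 1` otherwise. -/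
noncomputable def addBridge (hN : 2 ≤ N) (h : ZMod N) (c : Bool) (G : PlabicGraph N) :
    PlabicGraph N where
  toDiskMap := G.toDiskMap.addBridge hN h c
  meetsBoundary := G.meetsBoundary.addBridge hN h c
  isPlanar := G.isPlanar.addBridge hN h c

/-- The alphabet `{-1, …, -N} ⊔ {1, …, N}` of double affine braid words. -/
def BraidLetter (N : ℕ) : Type := {i : ℤ // i ≠ 0 ∧ |i| ≤ N}

/-- The affine plabic fence of the double affine braid word `w = (i₁, …, iₘ)`, obtained by adding
to `G` the bridges for `iₘ, …, i₁` in this order. -/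
noncomputable def affineFence (hN : 2 ≤ N) (w : List (BraidLetter N)) (G : PlabicGraph N) :
    PlabicGraph N :=
  w.foldr (fun i H => H.addBridge hN ((|i.1| : ℤ) : ZMod N) (decide (0 < i.1))) G

end PlabicGraph

/-! The base graph has a property stronger than simplicity: no edge has the same face on both sides
(`leftFace_ne`), and no two edges lie between the same two faces (`eq_other_of_leftFace_eq`).
Suppose it failed. A closed curve running through faces would then cross only one or two edges, and
one side of it would contain no boundary vertex. A strand that enters this inner part must leave it
along these edges. If each strand leaves along the edge by which it came, the part can be replaced
by vertices of degree one. If two strands exchange the two edges, these edges can be joined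
directly. Either surgery keeps the strand permutation and removes darts (`false_of_turn_back`,
`false_of_bypass`). By Euler's formula, however, a reduced trivalent graph has the fewest darts
among graphs of degree at most three with its strand permutation (`card_dart_le`). An edge joining
two boundary vertices is excluded by planarity alone.

The separation by a closed curve is obtained by counting cycles of permutations. A map is a triple
`next`, `bdryRot`, `other` whose product is the face walk. Each transposition changes the number of
cycles by one, which yields nonnegativity of the genus (`totalCycles_le`). A surgery that gains two
cycles on a planar map must therefore disconnect it.

For the bridges an induction needs `IsTame`, which concerns all faces, since a face at the boundary
may become interior later. A bridge creates one new face, and the only possible coincidence it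
causes is between the two new edges that run from its ends to the boundary. The ends of a bridge
have opposite colours, whereas the arrows of a directed 2-cycle require equal colours on either side
of the curve that crosses them. -/

section

open Equiv Equiv.Perm

/-! ### Merging two classes of an equivalence relation -/

section Glue

variable {A : Type}

/-- The equivalence relation obtained by merging the classes of two elements. -/
def Setoid.glue (s : Setoid A) (x y : A) : Setoid A where
  r a b := s a b ∨ ((s a x ∨ s a y) ∧ (s b x ∨ s b y))
  iseqv := by
    refine ⟨fun a => Or.inl (s.refl a), ?_, ?_⟩
    · rintro a b (h | ⟨h1, h2⟩)
      · exact Or.inl (s.symm h)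
      · exact Or.inr ⟨h2, h1⟩
    · rintro a b c (h | ⟨h1, h2⟩) (h' | ⟨h1', h2'⟩)
      · exact Or.inl (s.trans h h')
      · exact Or.inr ⟨h1'.imp (s.trans h) (s.trans h), h2'⟩
      · exact Or.inr ⟨h1, h2.imp (s.trans (s.symm h')) (s.trans (s.symm h'))⟩
      · exact Or.inr ⟨h1, h2'⟩

theorem Setoid.glue_of {s : Setoid A} (x y : A) {a b : A} (h : s a b) : s.glue x y a b := Or.inl h

theorem Setoid.glue_self (s : Setoid A) (x y : A) : s.glue x y x y :=
  Or.inr ⟨Or.inl (s.refl x), Or.inr (s.refl y)⟩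

theorem Setoid.glue_le {s t : Setoid A} {x y : A} (hst : ∀ a b, s a b → t a b) (h : t x y)
    {a b : A} (hab : s.glue x y a b) : t a b := by
  rcases hab with h1 | ⟨h1, h2⟩
  · exact hst _ _ h1
  · have key : ∀ c, s c x ∨ s c y → t c x := by
      rintro c (h3 | h3)
      · exact hst _ _ h3
      · exact t.trans (hst _ _ h3) (t.symm h)
    exact t.trans (key a h1) (t.symm (key b h2))

theorem card_quotient_le {A : Type} [Finite A] {s t : Setoid A} (h : ∀ a b, s a b → t a b) :
    Nat.card (Quotient t) ≤ Nat.card (Quotient s) :=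
  Nat.card_le_card_of_surjective (Quotient.map' (s₁ := s) (s₂ := t) id h) (by
    rintro ⟨a⟩
    exact ⟨Quotient.mk s a, rfl⟩)

/-- Every merged class still has a representative when the class of `x` is left out, because the
class of `y` stands for both. Hence the bijection with an `Option` type, in which `none` is the
class of `x`. -/
theorem card_quotient_glue [Finite A] (s : Setoid A) {x y : A} (h : ¬ s x y) :
    Nat.card (Quotient s) = Nat.card (Quotient (s.glue x y)) + 1 := by
  classical
  let F : A → Option (Quotient (s.glue x y)) := fun a =>
    if s a x then none else some (Quotient.mk _ a)
  have hF : ∀ a b, s a b → F a = F b := by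
    intro a b hab
    have : s a x ↔ s b x := ⟨fun h => s.trans (s.symm hab) h, fun h => s.trans hab h⟩
    by_cases ha : s a x
    · simp [F, ha, this.1 ha]
    · have hb : ¬ s b x := fun h => ha (this.2 h)
      simp only [F, ha, hb, if_false]
      exact congrArg some (Quotient.sound (Setoid.glue_of x y hab))
  have hbij : Function.Bijective (Quotient.lift F hF) := by
    constructor
    · rintro ⟨a⟩ ⟨b⟩ hab
      change F a = F b at hab
      refine Quotient.sound ?_
      by_cases ha : s a x <;> by_cases hb : s b x
      · exact s.trans ha (s.symm hb)
      · simp [F, ha, hb] at hab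
      · simp [F, ha, hb] at hab
      · simp only [F, ha, hb, if_false] at hab
        rcases Quotient.exact (Option.some.inj hab) with h1 | ⟨h1, h2⟩
        · exact h1
        · exact s.trans (h1.resolve_left ha) (s.symm (h2.resolve_left hb))
    · rintro (_ | ⟨⟨b⟩⟩)
      · exact ⟨Quotient.mk _ x, by change F x = _; simp [F]⟩
      · by_cases hb : s b x
        · refine ⟨Quotient.mk _ y, ?_⟩
          change F y = _
          have hy : ¬ s y x := fun h' => h (s.symm h')
          simp only [F, hy, if_false]
          exact congrArg some (Quotient.sound (Or.inr ⟨Or.inr (s.refl y), Or.inl hb⟩))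
        · refine ⟨Quotient.mk _ b, ?_⟩
          change F b = _
          simp only [F, hb, if_false]
          rfl
  rw [Nat.card_congr (Equiv.ofBijective _ hbij), Finite.card_option]

theorem card_quotient_le_glue [Finite A] (s : Setoid A) (x y : A) :
    Nat.card (Quotient s) ≤ Nat.card (Quotient (s.glue x y)) + 1 := by
  by_cases h : s x y
  · exact (card_quotient_le (fun a b hab => Setoid.glue_le (fun _ _ h => h) h hab)).trans
      (Nat.le_succ _)
  · exact (card_quotient_glue s h).le

end Glue

/-! ### Cycle counts, transpositions and nonnegativity of the genus -/

section Cycles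

variable {A : Type}

/-- The number of cycles of a permutation, fixed points included. -/
noncomputable def numCycles (f : Perm A) : ℕ := Nat.card (CyclesOf f)

theorem sameCycle_le_setoid {f : Perm A} (s : Setoid A) (h : ∀ a, s a (f a)) {a b : A}
    (hab : SameCycle f a b) : s a b := by
  have hp : ∀ a b, SameCycle f a b → s a b := by
    have hz : ∀ (n : ℤ) (a : A), s a ((f ^ n) a) := by
      intro n
      induction n with
      | zero => intro a; exact s.refl a
      | succ n ih =>
        intro a; rw [zpow_add_one, Perm.mul_apply]; exact s.trans (h a) (ih (f a))
      | pred n ih =>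
        intro a
        rw [zpow_sub_one, Perm.mul_apply]
        have := h (f⁻¹ a)
        rw [show f (f⁻¹ a) = a from f.apply_symm_apply a] at this
        exact s.trans (s.symm this) (ih _)
    rintro a b ⟨n, rfl⟩
    exact hz n a
  exact hp a b hab

theorem sameCycle_mem_iff {f : Perm A} {S : Set A} (hS : ∀ a, f a ∈ S ↔ a ∈ S) {a b : A}
    (h : SameCycle f a b) : a ∈ S ↔ b ∈ S := by
  let s : Setoid A := ⟨fun a b => a ∈ S ↔ b ∈ S,
    ⟨fun _ => Iff.rfl, fun h => h.symm, fun h1 h2 => h1.trans h2⟩⟩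
  exact sameCycle_le_setoid s (fun a => (hS a).symm) h

/-- The transposition alters the path of `x` only at its first return to `{x, y}`, where it
exchanges the two possible values. The cycle of `x` contains `y` exactly when this first return is
at `y`. -/
theorem sameCycle_swap_mul_iff [Finite A] [DecidableEq A] (f : Perm A) {x y : A} (hxy : x ≠ y) :
    SameCycle (swap x y * f) x y ↔ ¬ SameCycle f x y := by
  set g := swap x y * f with hg
  have hex : ∃ k, 0 < k ∧ ((f ^ k) x = x ∨ (f ^ k) x = y) :=
    ⟨orderOf f, orderOf_pos f, Or.inl (by rw [pow_orderOf_eq_one]; rfl)⟩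
  classical
  let k := Nat.find hex
  obtain ⟨hk, hkx⟩ := Nat.find_spec hex
  have hmin : ∀ j, j < k → 0 < j → (f ^ j) x ≠ x ∧ (f ^ j) x ≠ y := by
    intro j hj h0
    have := Nat.find_min hex hj
    push Not at this
    exact this h0
  have hgf : ∀ j, j < k → (g ^ j) x = (f ^ j) x := by
    intro j
    induction j with
    | zero => intro _; rfl
    | succ j ih =>
      intro hj
      obtain ⟨h1, h2⟩ := hmin (j + 1) hj (Nat.succ_pos _)
      rw [pow_succ', Perm.mul_apply, ih (by omega), hg, Perm.mul_apply]
      rw [pow_succ', Perm.mul_apply] at h1 h2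
      rw [swap_apply_of_ne_of_ne h1 h2, pow_succ', Perm.mul_apply]
  have hgk : (g ^ k) x = swap x y ((f ^ k) x) := by
    obtain ⟨j, hj⟩ : ∃ j, k = j + 1 := ⟨k - 1, by change 0 < k at hk; omega⟩
    rw [hj, pow_succ', Perm.mul_apply, hgf j (by omega), hg, Perm.mul_apply, pow_succ',
      Perm.mul_apply]
  -- If the path of `x` closes up after `k` steps without meeting `y`, reduction of exponents modulo
  -- `k` shows that it never meets `y`.
  have closed : ∀ h : Perm A, (h ^ k) x = x → (∀ j, j < k → (h ^ j) x ≠ y) →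
      ¬ SameCycle h x y := by
    intro h h1 h2 h3
    obtain ⟨i, _, hi⟩ := h3.exists_pow_eq'
    have h4 : (h ^ (i % k)) x = y := by
      have h5 : ∀ m, (h ^ (k * m)) x = x := by
        intro m
        rw [pow_mul]
        induction m with
        | zero => rfl
        | succ m ih => rw [pow_succ, Perm.mul_apply, h1, ih]
      rw [← hi]
      conv_rhs => rw [← Nat.mod_add_div i k, pow_add, Perm.mul_apply, h5]
    exact h2 _ (Nat.mod_lt _ hk) h4
  have hne : ∀ j, j < k → (f ^ j) x ≠ y := by
    intro j hj
    rcases Nat.eq_zero_or_pos j with rfl | h0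
    · exact hxy
    · exact (hmin j hj h0).2
  change (f ^ k) x = x ∨ (f ^ k) x = y at hkx
  rcases hkx with h1 | h1
  · have h2 : (g ^ k) x = y := by rw [hgk, h1, swap_apply_left]
    exact ⟨fun _ => closed f h1 hne, fun _ => ⟨k, by simpa using h2⟩⟩
  · have h2 : (g ^ k) x = x := by rw [hgk, h1, swap_apply_right]
    refine ⟨fun h3 => absurd h3 (closed g h2 fun j hj => by rw [hgf j hj]; exact hne j hj),
      fun h3 => absurd ⟨k, by simpa using h1⟩ h3⟩

/-- The two permutations differ only in steps that land on `x` or `y`, so a new step stays within a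
merged class. Conversely, `x` and `y` now share a cycle, which makes up for each altered step. -/
theorem sameCycle_swap_mul_of_not [Finite A] [DecidableEq A] (f : Perm A) {x y : A}
    (h : ¬ SameCycle f x y) {a b : A} :
    SameCycle (swap x y * f) a b ↔ (SameCycle.setoid f).glue x y a b := by
  have hxy : x ≠ y := fun e => h (e ▸ SameCycle.refl _ _)
  have hg := (sameCycle_swap_mul_iff f hxy).2 h
  constructor
  · refine sameCycle_le_setoid _ fun a => ?_
    rw [Perm.mul_apply]
    have h1 : SameCycle f a (f a) := sameCycle_apply_right.2 (SameCycle.refl _ _)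
    by_cases hx : f a = x
    · rw [hx, swap_apply_left]
      exact Or.inr ⟨Or.inl (hx ▸ h1), Or.inr (SameCycle.refl _ _)⟩
    by_cases hy : f a = y
    · rw [hy, swap_apply_right]
      exact Or.inr ⟨Or.inr (hy ▸ h1), Or.inl (SameCycle.refl _ _)⟩
    rw [swap_apply_of_ne_of_ne hx hy]
    exact Or.inl h1
  · refine Setoid.glue_le (t := SameCycle.setoid (swap x y * f)) (fun a b => ?_) hg
    refine sameCycle_le_setoid _ fun a => ?_
    have h1 : SameCycle (swap x y * f) a (swap x y (f a)) :=
      sameCycle_apply_right.2 (SameCycle.refl _ _)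
    by_cases hx : f a = x
    · rw [hx, swap_apply_left] at h1
      rw [hx]; exact h1.trans hg.symm
    by_cases hy : f a = y
    · rw [hy, swap_apply_right] at h1
      rw [hy]; exact h1.trans hg
    rwa [swap_apply_of_ne_of_ne hx hy] at h1

theorem numCycles_swap_mul_of_not [Finite A] [DecidableEq A] (f : Perm A) {x y : A}
    (h : ¬ SameCycle f x y) : numCycles f = numCycles (swap x y * f) + 1 := by
  have e : SameCycle.setoid (swap x y * f) = (SameCycle.setoid f).glue x y :=
    Setoid.ext fun a b => sameCycle_swap_mul_of_not f h
  unfold numCycles CyclesOf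
  rw [e]
  exact card_quotient_glue _ h

theorem numCycles_swap_mul_of_sameCycle [Finite A] [DecidableEq A] (f : Perm A) {x y : A}
    (hxy : x ≠ y) (h : SameCycle f x y) : numCycles (swap x y * f) = numCycles f + 1 := by
  have h1 : ¬ SameCycle (swap x y * f) x y := fun h2 => (sameCycle_swap_mul_iff f hxy).1 h2 h
  have := numCycles_swap_mul_of_not _ h1
  rwa [swap_mul_self_mul] at this

/-- Splitting the cycle of `x` and `y` does not affect the other cycles. -/
theorem sameCycle_swap_mul_of_not_mem [Finite A] [DecidableEq A] (f : Perm A) {x y a b : A}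
    (h : SameCycle f x y) (hab : SameCycle f a b) (ha : ¬ SameCycle f a x) :
    SameCycle (swap x y * f) a b := by
  by_cases hxy : x = y
  · subst hxy; rwa [show swap x x = 1 from swap_self x, one_mul]
  have h1 : ¬ SameCycle (swap x y * f) x y := fun h2 => (sameCycle_swap_mul_iff f hxy).1 h2 h
  have h2 := fun a b => sameCycle_swap_mul_of_not (swap x y * f) h1 (a := a) (b := b)
  simp only [swap_mul_self_mul] at h2
  rcases (h2 a b).1 hab with h3 | ⟨h3, h4⟩
  · exact h3
  · exact absurd ((h2 a x).2 (Or.inr ⟨h3, Or.inl (SameCycle.refl _ _)⟩)) ha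

theorem numCycles_conj (f g : Perm A) : numCycles (g * f * g⁻¹) = numCycles f := by
  refine Nat.card_congr (Quotient.congr g⁻¹ fun a b => ?_)
  exact sameCycle_conj

theorem numCycles_mul_comm (f g : Perm A) : numCycles (f * g) = numCycles (g * f) := by
  rw [← numCycles_conj (g * f) f]
  congr 1
  group

theorem mul_swap_eq [DecidableEq A] (f : Perm A) (x y : A) :
    f * swap x y = swap (f x) (f y) * f := by
  rw [mul_swap_eq_swap_mul]

theorem numCycles_mul_swap_of_sameCycle [Finite A] [DecidableEq A] (f : Perm A) {x y : A}
    (hxy : x ≠ y) (h : SameCycle f x y) : numCycles (f * swap x y) = numCycles f + 1 := by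
  rw [mul_swap_eq]
  exact numCycles_swap_mul_of_sameCycle f (fun e => hxy (f.injective e))
    (sameCycle_apply_left.2 (sameCycle_apply_right.2 h))

theorem sameCycle_mul_swap_of_not_mem [Finite A] [DecidableEq A] (f : Perm A) {x y a b : A}
    (h : SameCycle f x y) (hab : SameCycle f a b) (ha : ¬ SameCycle f a x) :
    SameCycle (f * swap x y) a b := by
  rw [mul_swap_eq]
  exact sameCycle_swap_mul_of_not_mem f (sameCycle_apply_left.2 (sameCycle_apply_right.2 h)) hab
    (fun h2 => ha (sameCycle_apply_right.1 h2))

theorem numCycles_one : numCycles (1 : Perm A) = Nat.card A := by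
  refine (Nat.card_congr (Equiv.ofBijective (Quotient.mk (SameCycle.setoid (1 : Perm A))) ?_)).symm
  refine ⟨fun a b h => sameCycle_one.1 (Quotient.exact h), Quotient.mk_surjective⟩

theorem numCycles_le [Finite A] (f : Perm A) : numCycles f ≤ Nat.card A :=
  Nat.card_le_card_of_surjective (Quotient.mk (SameCycle.setoid f)) Quotient.mk_surjective

/-- The product of the transpositions of a list of pairs. -/
def swapProd [DecidableEq A] (l : List (A × A)) : Perm A := (l.map fun p => swap p.1 p.2).prod

/-- If `x` is moved, the transposition of `x` and its image splits `x` off as a fixed point and adds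
one cycle. The identity, which has the most cycles, is reached after `Nat.card A - numCycles f` such
steps. -/
theorem exists_swapProd_eq [Finite A] [DecidableEq A] (f : Perm A) :
    ∃ l : List (A × A), swapProd l = f ∧ l.length + numCycles f = Nat.card A := by
  generalize hn : Nat.card A - numCycles f = n
  induction n generalizing f with
  | zero =>
    by_cases h : f = 1
    · exact ⟨[], by simp [swapProd, h], by simp [h, numCycles_one]⟩
    · obtain ⟨x, hx⟩ : ∃ x, f x ≠ x := by
        by_contra! h'
        exact h (Equiv.ext h')
      have h1 := numCycles_swap_mul_of_sameCycle f (Ne.symm hx) (DiskMap.sameCycle_step rfl)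
      have h2 := numCycles_le (swap x (f x) * f)
      omega
  | succ n ih =>
    obtain ⟨x, hx⟩ : ∃ x, f x ≠ x := by
      by_contra! h'
      have : f = 1 := Equiv.ext h'
      rw [this, numCycles_one] at hn
      omega
    have h1 := numCycles_swap_mul_of_sameCycle f (Ne.symm hx) (DiskMap.sameCycle_step rfl)
    have h2 := numCycles_le (swap x (f x) * f)
    obtain ⟨l, hl, hc⟩ := ih (swap x (f x) * f) (by omega)
    refine ⟨(x, f x) :: l, ?_, by simp only [List.length_cons]; omega⟩
    change swap x (f x) * swapProd l = f
    rw [hl, swap_mul_self_mul]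

/-- The finest equivalence relation that relates the elements of cycles of `f` and the two
entries of each pair of a list. -/
def glueList (f : Perm A) : List (A × A) → Setoid A
  | [] => SameCycle.setoid f
  | p :: l => (glueList f l).glue p.1 p.2

theorem glueList_of_sameCycle {f : Perm A} (l : List (A × A)) {a b : A} (h : SameCycle f a b) :
    glueList f l a b := by
  induction l with
  | nil => exact h
  | cons p l ih => exact Setoid.glue_of _ _ ih

theorem glueList_swapProd [DecidableEq A] (f : Perm A) (l : List (A × A)) (a : A) :
    glueList f l a (swapProd l a) := by
  induction l generalizing a with
  | nil => exact SameCycle.refl _ _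
  | cons p l ih =>
    have e : swapProd (p :: l) a = swap p.1 p.2 (swapProd l a) := rfl
    rw [e]
    have h1 : glueList f (p :: l) a (swapProd l a) := Setoid.glue_of _ _ (ih a)
    refine (glueList f (p :: l)).trans h1 ?_
    have h2 := Setoid.glue_self (glueList f l) p.1 p.2
    by_cases hx : swapProd l a = p.1
    · rw [hx, swap_apply_left]; exact h2
    by_cases hy : swapProd l a = p.2
    · rw [hy, swap_apply_right]; exact (glueList f (p :: l)).symm h2
    rw [swap_apply_of_ne_of_ne hx hy]

theorem glueList_append_left {f : Perm A} (l l' : List (A × A)) {a b : A}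
    (h : glueList f l' a b) : glueList f (l ++ l') a b := by
  induction l with
  | nil => exact h
  | cons p l ih => exact Setoid.glue_of _ _ ih

theorem glueList_append_right {f : Perm A} (l l' : List (A × A)) {a b : A}
    (h : glueList f l a b) : glueList f (l ++ l') a b := by
  induction l generalizing a b with
  | nil => exact glueList_of_sameCycle l' h
  | cons p l ih =>
    exact Setoid.glue_le (t := glueList f (p :: l ++ l'))
      (fun a b h => Setoid.glue_of _ _ (ih h)) (Setoid.glue_self _ _ _) h

/-- A transposition that joins two cycles costs one cycle and at most one class. One that splits a
cycle gains a cycle, but its entries are already related, so no class is lost. In both cases the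
additional unit of length settles the balance. -/
theorem numCycles_add_swapProd_mul_le [Finite A] [DecidableEq A] (f : Perm A)
    (l : List (A × A)) :
    numCycles f + numCycles (swapProd l * f) ≤
      2 * Nat.card (Quotient (glueList f l)) + l.length := by
  induction l with
  | nil =>
    have : swapProd ([] : List (A × A)) * f = f := by simp [swapProd]
    rw [this]
    change numCycles f + numCycles f ≤ 2 * numCycles f + 0
    omega
  | cons p l ih =>
    obtain ⟨x, y⟩ := p
    have e : swapProd ((x, y) :: l) * f = swap x y * (swapProd l * f) := by
      rw [← mul_assoc]; rfl
    rw [e]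
    have h0 := card_quotient_le_glue (glueList f l) x y
    change _ ≤ 2 * Nat.card (Quotient ((glueList f l).glue x y)) + (l.length + 1)
    by_cases h : SameCycle (swapProd l * f) x y
    · have h1 : glueList f l x y := by
        refine sameCycle_le_setoid (glueList f l) (fun a => ?_) h
        exact (glueList f l).trans (glueList_of_sameCycle l (DiskMap.sameCycle_step rfl))
          (glueList_swapProd f l (f a))
      have h2 : Nat.card (Quotient (glueList f l)) ≤
          Nat.card (Quotient ((glueList f l).glue x y)) :=
        card_quotient_le fun a b hab => Setoid.glue_le (fun _ _ h => h) h1 hab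
      have h3 : numCycles (swap x y * (swapProd l * f)) ≤ numCycles (swapProd l * f) + 1 := by
        by_cases hxy : x = y
        · subst hxy; rw [show swap x x = 1 from swap_self x, one_mul]; exact Nat.le_succ _
        · exact (numCycles_swap_mul_of_sameCycle _ hxy h).le
      omega
    · have := numCycles_swap_mul_of_not _ h
      omega

/-- Two elements are in the same orbit of three permutations if no invariant set separates
them. -/
def orbitSetoid (f g h : Perm A) : Setoid A where
  r a b := ∀ S : Set A, (∀ x, f x ∈ S ↔ x ∈ S) → (∀ x, g x ∈ S ↔ x ∈ S) →
    (∀ x, h x ∈ S ↔ x ∈ S) → (a ∈ S ↔ b ∈ S)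
  iseqv := ⟨fun _ _ _ _ _ => Iff.rfl, fun h S h1 h2 h3 => (h S h1 h2 h3).symm,
    fun h h' S h1 h2 h3 => (h S h1 h2 h3).trans (h' S h1 h2 h3)⟩

/-- The number of orbits of three permutations. -/
noncomputable def numOrbits (f g h : Perm A) : ℕ := Nat.card (Quotient (orbitSetoid f g h))

theorem orbitSetoid_le {f g h : Perm A} {t : Setoid A} (hf : ∀ x, t x (f x))
    (hg : ∀ x, t x (g x)) (hh : ∀ x, t x (h x)) {a b : A} (hab : orbitSetoid f g h a b) :
    t a b := by
  have key : ∀ k : Perm A, (∀ x, t x (k x)) → ∀ x, k x ∈ {z | t a z} ↔ x ∈ {z | t a z} :=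
    fun k hk x => ⟨fun h1 => t.trans h1 (t.symm (hk x)), fun h1 => t.trans h1 (hk x)⟩
  exact (hab {z | t a z} (key f hf) (key g hg) (key h hh)).1 (t.refl a)

theorem orbitSetoid_fst (f g h : Perm A) (x : A) : orbitSetoid f g h x (f x) :=
  fun _ h1 _ _ => (h1 x).symm

theorem orbitSetoid_snd (f g h : Perm A) (x : A) : orbitSetoid f g h x (g x) :=
  fun _ _ h1 _ => (h1 x).symm

theorem orbitSetoid_trd (f g h : Perm A) (x : A) : orbitSetoid f g h x (h x) :=
  fun _ _ _ h1 => (h1 x).symm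

/-- The total number of cycles of three permutations and their product. -/
noncomputable def totalCycles (f g h : Perm A) : ℕ :=
  numCycles f + numCycles g + numCycles h + numCycles (f * g * h)

/-- The Riemann–Hurwitz inequality: the genus is not negative. -/
theorem totalCycles_le [Finite A] (f g h : Perm A) :
    totalCycles f g h ≤ 2 * Nat.card A + 2 * numOrbits f g h := by
  classical
  obtain ⟨l, hl, hlc⟩ := exists_swapProd_eq g
  obtain ⟨m, hm, hmc⟩ := exists_swapProd_eq h
  -- The two factorizations together use `2 * Nat.card A - numCycles g - numCycles h`
  -- transpositions.
  have h1 := numCycles_add_swapProd_mul_le f (l ++ m)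
  have h2 : swapProd (l ++ m) = g * h := by
    rw [← hl, ← hm]; simp [swapProd]
  have h3 : numCycles (swapProd (l ++ m) * f) = numCycles (f * g * h) := by
    rw [h2, numCycles_mul_comm, mul_assoc]
  have h4 : Nat.card (Quotient (glueList f (l ++ m))) ≤ numOrbits f g h := by
    refine card_quotient_le fun a b hab => orbitSetoid_le ?_ ?_ ?_ hab
    · exact fun x => glueList_of_sameCycle _ (DiskMap.sameCycle_step rfl)
    · intro x
      rw [← hl]
      exact glueList_append_right l m (glueList_swapProd f l x)
    · intro x
      rw [← hm]
      exact glueList_append_left l m (glueList_swapProd f m x)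
  rw [h3, List.length_append] at h1
  unfold totalCycles
  omega

/-- Three permutations encode a planar map, possibly disconnected. -/
def IsPlanarTriple (f g h : Perm A) : Prop :=
  totalCycles f g h = 2 * Nat.card A + 2 * numOrbits f g h

end Cycles

/-! ### Splitting a vertex of a planar map -/

section Planar

variable {A : Type}

/-- Where the two permutations disagree, their values are `x` and `y` in some order, and these are
related after merging. This serves to bound the number of orbits that a splitting can create. -/
theorem swap_mul_glue [DecidableEq A] {s : Setoid A} {f : Perm A} {x y : A}
    (h : ∀ a, s a ((swap x y * f) a)) (a : A) : s.glue x y a (f a) := by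
  have h1 := h a
  have h2 := s.glue_self x y
  rw [Perm.mul_apply] at h1
  by_cases hx : f a = x
  · rw [hx, swap_apply_left] at h1
    rw [hx]; exact (s.glue x y).trans (Setoid.glue_of _ _ h1) ((s.glue x y).symm h2)
  by_cases hy : f a = y
  · rw [hy, swap_apply_right] at h1
    rw [hy]; exact (s.glue x y).trans (Setoid.glue_of _ _ h1) h2
  rw [swap_apply_of_ne_of_ne hx hy] at h1
  exact Setoid.glue_of _ _ h1

theorem orbitSetoid_mul (f g h : Perm A) (x : A) : orbitSetoid f g h x ((f * g * h) x) :=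
  (orbitSetoid f g h).trans (orbitSetoid_trd f g h x)
    ((orbitSetoid f g h).trans (orbitSetoid_snd f g h _) (orbitSetoid_fst f g h _))

variable [Finite A]

theorem numOrbits_le_succ_of_glue {f g h f' g' h' : Perm A} (x y : A)
    (hf : ∀ a, (orbitSetoid f' g' h').glue x y a (f a))
    (hg : ∀ a, (orbitSetoid f' g' h').glue x y a (g a))
    (hh : ∀ a, (orbitSetoid f' g' h').glue x y a (h a)) :
    numOrbits f' g' h' ≤ numOrbits f g h + 1 := by
  have h1 := card_quotient_le_glue (orbitSetoid f' g' h') x y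
  have h2 : Nat.card (Quotient ((orbitSetoid f' g' h').glue x y)) ≤ numOrbits f g h :=
    card_quotient_le fun a b hab => orbitSetoid_le hf hg hh hab
  unfold numOrbits at *
  omega

/-- Splitting a vertex that meets some face at two places disconnects a planar map. -/
theorem IsPlanarTriple.swap_mul_of_sameCycle [DecidableEq A] {f g h : Perm A}
    (hP : IsPlanarTriple f g h) {x y : A} (hxy : x ≠ y) (hf : SameCycle f x y)
    (hF : SameCycle (f * g * h) x y) :
    IsPlanarTriple (swap x y * f) g h ∧
      numOrbits (swap x y * f) g h = numOrbits f g h + 1 := by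
  have h1 := numCycles_swap_mul_of_sameCycle f hxy hf
  have h2 := numCycles_swap_mul_of_sameCycle (f * g * h) hxy hF
  have h3 : swap x y * (f * g * h) = swap x y * f * g * h := by simp only [mul_assoc]
  -- One vertex and one face have been gained, so this bound forces a further orbit. Reuniting `x`
  -- and `y` shows that there is at most one.
  have h4 := totalCycles_le (swap x y * f) g h
  have h5 : numOrbits (swap x y * f) g h ≤ numOrbits f g h + 1 := by
    refine numOrbits_le_succ_of_glue x y (swap_mul_glue fun a => ?_) (fun a => ?_) (fun a => ?_)
    · exact orbitSetoid_fst _ _ _ _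
    · exact Setoid.glue_of _ _ (orbitSetoid_snd _ _ _ _)
    · exact Setoid.glue_of _ _ (orbitSetoid_trd _ _ _ _)
  rw [h3] at h2
  unfold IsPlanarTriple totalCycles at *
  omega

/-- Splitting a vertex preserves planarity. -/
theorem IsPlanarTriple.swap_mul [DecidableEq A] {f g h : Perm A}
    (hP : IsPlanarTriple f g h) {x y : A} (hf : SameCycle f x y) :
    IsPlanarTriple (swap x y * f) g h := by
  by_cases hxy : x = y
  · subst hxy; rwa [show swap x x = 1 from swap_self x, one_mul]
  by_cases hF : SameCycle (f * g * h) x y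
  · exact (hP.swap_mul_of_sameCycle hxy hf hF).1
  have h1 := numCycles_swap_mul_of_sameCycle f hxy hf
  have h2 := numCycles_swap_mul_of_not (f * g * h) hF
  have h3 : swap x y * (f * g * h) = swap x y * f * g * h := by simp only [mul_assoc]
  have h4 := totalCycles_le (swap x y * f) g h
  -- The faces at `x` and `y` have been joined, so `x` and `y` remain in one orbit. The vertex
  -- gained and the face lost cancel in the total.
  have h6 : orbitSetoid (swap x y * f) g h x y := by
    refine sameCycle_le_setoid _ (orbitSetoid_mul (swap x y * f) g h) ?_
    rw [← h3]
    exact (sameCycle_swap_mul_iff _ hxy).2 hF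
  have h5 : numOrbits (swap x y * f) g h ≤ numOrbits f g h := by
    have key := fun a b => Setoid.glue_le (s := orbitSetoid (swap x y * f) g h)
      (t := orbitSetoid (swap x y * f) g h) (fun _ _ h => h) h6 (a := a) (b := b)
    refine card_quotient_le fun a b hab => orbitSetoid_le (fun a => ?_) (fun a => ?_)
      (fun a => ?_) hab
    · exact key _ _ (swap_mul_glue (fun a => orbitSetoid_fst _ _ _ _) a)
    · exact orbitSetoid_snd _ _ _ _
    · exact orbitSetoid_trd _ _ _ _
  rw [h3] at h2
  unfold IsPlanarTriple totalCycles at *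
  omega

end Planar

/-! ### Planarity of unions of components -/

section Restrict

variable {A : Type} [Finite A] {K : A → Prop}

theorem numCycles_subtypePerm_add (f : Perm A) (hf : ∀ x, K (f x) ↔ K x) :
    numCycles (f.subtypePerm hf) +
      numCycles (f.subtypePerm (p := fun x => ¬ K x) fun x => not_congr (hf x)) =
      numCycles f := by
  classical
  let p : A → CyclesOf (f.subtypePerm hf) ⊕
      CyclesOf (f.subtypePerm (p := fun x => ¬ K x) fun x => not_congr (hf x)) := fun a =>
    if h : K a then Sum.inl (Quotient.mk _ ⟨a, h⟩) else Sum.inr (Quotient.mk _ ⟨a, h⟩)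
  let s : CyclesOf (f.subtypePerm hf) ⊕
      CyclesOf (f.subtypePerm (p := fun x => ¬ K x) fun x => not_congr (hf x)) → A :=
    Sum.elim (fun t => t.out.1) (fun t => t.out.1)
  have key := DiskMap.card_cyclesOf f p s ?_ ?_ ?_
  · unfold numCycles
    rw [key, Nat.card_sum]
  · intro a
    by_cases h : K a
    · have h' := (hf a).2 h
      simp only [p, h, h', dif_pos]
      exact congrArg Sum.inl (DiskMap.mk_apply_eq (f.subtypePerm hf) ⟨a, h⟩)
    · have h' := mt (hf a).1 h
      simp only [p, h, h', dif_neg, not_false_eq_true]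
      exact congrArg Sum.inr (DiskMap.mk_apply_eq
        (f.subtypePerm (p := fun x => ¬ K x) fun x => not_congr (hf x)) ⟨a, h⟩)
  · rintro (t | t)
    · change p t.out.1 = _
      simp only [p, t.out.2, dif_pos]
      exact congrArg Sum.inl t.out_eq
    · change p t.out.1 = _
      simp only [p, t.out.2, dif_neg, not_false_eq_true]
      exact congrArg Sum.inr t.out_eq
  · intro a
    by_cases h : K a
    · simp only [p, h, dif_pos, s, Sum.elim_inl]
      exact (sameCycle_subtypePerm.1 (Quotient.exact (Quotient.out_eq (Quotient.mk
        (SameCycle.setoid (f.subtypePerm hf)) ⟨a, h⟩)))).symm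
    · simp only [p, h, dif_neg, not_false_eq_true, s, Sum.elim_inr]
      exact (sameCycle_subtypePerm.1 (Quotient.exact (Quotient.out_eq (Quotient.mk
        (SameCycle.setoid
          (f.subtypePerm (p := fun x => ¬ K x) fun x => not_congr (hf x))) ⟨a, h⟩)))).symm

/-- Orbits of the two parts are not merged in the whole. The inequality is enough: cycles and
elements add up over the parts, so planarity of the whole forces equality in the genus bound of each
part. -/
theorem numOrbits_subtypePerm_add (f g h : Perm A) (hf : ∀ x, K (f x) ↔ K x)
    (hg : ∀ x, K (g x) ↔ K x) (hh : ∀ x, K (h x) ↔ K x) :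
    numOrbits (f.subtypePerm hf) (g.subtypePerm hg) (h.subtypePerm hh) +
      numOrbits (f.subtypePerm (p := fun x => ¬ K x) fun x => not_congr (hf x))
        (g.subtypePerm (p := fun x => ¬ K x) fun x => not_congr (hg x))
        (h.subtypePerm (p := fun x => ¬ K x) fun x => not_congr (hh x)) ≤
      numOrbits f g h := by
  classical
  let s := orbitSetoid (f.subtypePerm hf) (g.subtypePerm hg) (h.subtypePerm hh)
  let s' := orbitSetoid (f.subtypePerm (p := fun x => ¬ K x) fun x => not_congr (hf x))
        (g.subtypePerm (p := fun x => ¬ K x) fun x => not_congr (hg x))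
        (h.subtypePerm (p := fun x => ¬ K x) fun x => not_congr (hh x))
  let p : A → Quotient s ⊕ Quotient s' := fun a =>
    if h : K a then Sum.inl (Quotient.mk _ ⟨a, h⟩) else Sum.inr (Quotient.mk _ ⟨a, h⟩)
  have key : ∀ (k : Perm A) (hk : ∀ x, K (k x) ↔ K x),
      (∀ x, s x (k.subtypePerm hk x)) →
      (∀ x, s' x (k.subtypePerm (p := fun x => ¬ K x) (fun x => not_congr (hk x)) x)) →
      ∀ x, Setoid.ker p x (k x) := by
    intro k hk h1 h2 a
    change p a = p (k a)
    by_cases h : K a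
    · have h' := (hk a).2 h
      simp only [p, h, h', dif_pos]
      exact congrArg Sum.inl (Quotient.sound (h1 ⟨a, h⟩))
    · have h' := mt (hk a).1 h
      simp only [p, h, h', dif_neg, not_false_eq_true]
      exact congrArg Sum.inr (Quotient.sound (h2 ⟨a, h⟩))
  have hp : ∀ a b, orbitSetoid f g h a b → p a = p b := fun a b hab =>
    orbitSetoid_le (t := Setoid.ker p)
      (key f hf (orbitSetoid_fst _ _ _) (orbitSetoid_fst _ _ _))
      (key g hg (orbitSetoid_snd _ _ _) (orbitSetoid_snd _ _ _))
      (key h hh (orbitSetoid_trd _ _ _) (orbitSetoid_trd _ _ _)) hab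
  change Nat.card (Quotient s) + Nat.card (Quotient s') ≤ Nat.card (Quotient (orbitSetoid f g h))
  rw [← Nat.card_sum]
  refine Nat.card_le_card_of_surjective (Quotient.lift p hp) ?_
  rintro (⟨⟨a, ha⟩⟩ | ⟨⟨a, ha⟩⟩)
  · refine ⟨Quotient.mk _ a, ?_⟩
    change p a = _
    simp only [p, ha, dif_pos]; rfl
  · refine ⟨Quotient.mk _ a, ?_⟩
    change p a = _
    simp only [p, ha, dif_neg, not_false_eq_true]; rfl

/-- A union of connected components of a planar map is planar. -/
theorem IsPlanarTriple.subtypePerm {f g h : Perm A} (hP : IsPlanarTriple f g h)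
    (hf : ∀ x, K (f x) ↔ K x) (hg : ∀ x, K (g x) ↔ K x) (hh : ∀ x, K (h x) ↔ K x) :
    IsPlanarTriple (f.subtypePerm hf) (g.subtypePerm hg) (h.subtypePerm hh) := by
  have h1 := numCycles_subtypePerm_add f hf
  have h2 := numCycles_subtypePerm_add g hg
  have h3 := numCycles_subtypePerm_add h hh
  have h4 := numCycles_subtypePerm_add (f * g * h) (K := K)
    (fun x => ((hf _).trans (hg _)).trans (hh x))
  have h5 := numOrbits_subtypePerm_add f g h hf hg hh
  have h6 := totalCycles_le (f.subtypePerm hf) (g.subtypePerm hg) (h.subtypePerm hh)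
  have h7 := totalCycles_le (f.subtypePerm (p := fun x => ¬ K x) fun x => not_congr (hf x))
        (g.subtypePerm (p := fun x => ¬ K x) fun x => not_congr (hg x))
        (h.subtypePerm (p := fun x => ¬ K x) fun x => not_congr (hh x))
  have h8 : Nat.card {x // K x} + Nat.card {x // ¬ K x} = Nat.card A := by
    classical
    rw [← Nat.card_sum, Nat.card_congr (Equiv.sumCompl K)]
  have e1 : f.subtypePerm hf * g.subtypePerm hg * h.subtypePerm hh =
    (f * g * h).subtypePerm (fun x => ((hf _).trans (hg _)).trans (hh x)) := rfl
  have e2 : f.subtypePerm (p := fun x => ¬ K x) (fun x => not_congr (hf x)) *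
      g.subtypePerm (p := fun x => ¬ K x) (fun x => not_congr (hg x)) *
      h.subtypePerm (p := fun x => ¬ K x) (fun x => not_congr (hh x)) =
    (f * g * h).subtypePerm (p := fun x => ¬ K x)
      (fun x => not_congr (((hf _).trans (hg _)).trans (hh x))) := rfl
  unfold IsPlanarTriple totalCycles at *
  rw [e1] at h6 ⊢
  rw [e2] at h7
  omega

end Restrict

/-! ### Vertex counts from degrees -/

section Count

variable {A : Type} [Finite A]

theorem card_eq_sum_fiber (f : Perm A) [Fintype (CyclesOf f)] :
    Nat.card A = ∑ t : CyclesOf f, Nat.card {a // (Quotient.mk _ a : CyclesOf f) = t} := by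
  rw [← Nat.card_sigma]
  exact Nat.card_congr (Equiv.sigmaFiberEquiv (fun a => (Quotient.mk _ a : CyclesOf f))).symm

theorem card_fiber_mk {A : Type} (f : Perm A) (a : A) :
    Nat.card {b // (Quotient.mk _ b : CyclesOf f) = Quotient.mk _ a} =
      {b | SameCycle f b a}.ncard :=
  Nat.card_congr (Equiv.subtypeEquivRight fun _ => Quotient.eq)

theorem card_eq_two_mul_numCycles (f : Perm A) (h : ∀ a, f (f a) = a) (h' : ∀ a, f a ≠ a) :
    Nat.card A = 2 * numCycles f := by
  classical
  have := Fintype.ofFinite (CyclesOf f)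
  rw [card_eq_sum_fiber f, Finset.sum_const_nat (m := 2)]
  · unfold numCycles
    rw [Nat.card_eq_fintype_card, mul_comm]; rfl
  · rintro ⟨a⟩ _
    refine (card_fiber_mk f a).trans ?_
    have : {b | SameCycle f b a} = {a, f a} := by
      ext b
      constructor
      · intro hb
        refine (sameCycle_mem_iff (S := {a, f a}) (fun x => ?_) hb).2 (by simp)
        simp only [Set.mem_insert_iff, Set.mem_singleton_iff, EmbeddingLike.apply_eq_iff_eq]
        constructor
        · rintro (h1 | h1)
          · right; rw [← h1, h]
          · left; exact h1
        · rintro (h1 | h1)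
          · right; exact h1
          · left; rw [h1, h]
      · rintro (rfl | rfl)
        · exact SameCycle.refl _ _
        · exact sameCycle_apply_left.2 (SameCycle.refl _ _)
    rw [this, Set.ncard_pair (h' a).symm]

/-- Each cycle has at most three elements, and that of a marked fixed point has only one, which
leaves two to spare. Distinct marked points have distinct cycles because they are fixed. -/
theorem card_add_two_mul_le_of_fixed {ι : Type} [Finite ι] (f : Perm A)
    (h : ∀ a, f a = a ∨ f (f a) = a ∨ f (f (f a)) = a) (b : ι ↪ A) (hb : ∀ i, f (b i) = b i) :
    Nat.card A + 2 * Nat.card ι ≤ 3 * numCycles f := by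
  classical
  have := Fintype.ofFinite (CyclesOf f)
  have := Fintype.ofFinite ι
  have hinj : Function.Injective fun i => (Quotient.mk _ (b i) : CyclesOf f) := by
    intro i j hij
    exact b.injective ((Quotient.exact hij : SameCycle f _ _).eq_of_left (hb i))
  have h1 : ∀ t : CyclesOf f, Nat.card {a // (Quotient.mk _ a : CyclesOf f) = t} +
      2 * (if t ∈ Finset.univ.image (fun i => (Quotient.mk _ (b i) : CyclesOf f)) then 1 else 0)
        ≤ 3 := by
    rintro ⟨a⟩
    have e := card_fiber_mk f a
    change Nat.card {b // (Quotient.mk _ b : CyclesOf f) = Quotient.mk _ a} + _ ≤ 3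
    rw [e]
    split_ifs with ht
    · obtain ⟨i, -, hi⟩ := Finset.mem_image.1 ht
      have h2 : b i = a := (Quotient.exact hi : SameCycle f _ _).eq_of_left (hb i)
      subst h2
      have : {c | SameCycle f c (b i)} = {b i} := by
        ext c
        exact ⟨fun h => h.eq_of_right (hb i), fun h => h ▸ SameCycle.refl _ _⟩
      rw [this, Set.ncard_singleton]
    · have hsub : {c | SameCycle f c a} ⊆ {a, f a, f (f a)} := by
        intro c hc
        refine (sameCycle_mem_iff (S := {a, f a, f (f a)}) (fun x => ?_) hc).2 (by simp)
        simp only [Set.mem_insert_iff, Set.mem_singleton_iff, EmbeddingLike.apply_eq_iff_eq]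
        rcases h a with h1 | h1 | h1
        · simp only [h1, or_self]
          rw [← f.injective.eq_iff (a := x), h1]
          tauto
        · rw [h1]
          rw [← f.injective.eq_iff (a := x) (b := f a), h1]
          tauto
        · rw [← f.injective.eq_iff (a := x) (b := f (f a)), h1]
          tauto
      have h2 := Set.ncard_le_ncard hsub (Set.toFinite _)
      have h3 : ({a, f a, f (f a)} : Set A).ncard ≤ 3 := by
        refine (Set.ncard_insert_le _ _).trans ?_
        have := Set.ncard_insert_le (f a) {f (f a)}
        rw [Set.ncard_singleton] at this
        omega
      omega
  have h2 := Finset.sum_le_sum (s := Finset.univ) fun t _ => h1 t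
  rw [Finset.sum_add_distrib, ← card_eq_sum_fiber, ← Finset.mul_sum, Finset.sum_boole,
    Finset.filter_mem_eq_inter, Finset.univ_inter, Finset.card_image_of_injective _ hinj] at h2
  simp only [Finset.sum_const, Finset.card_univ, smul_eq_mul] at h2
  unfold numCycles
  rw [Nat.card_eq_fintype_card (α := CyclesOf f), Nat.card_eq_fintype_card (α := ι), mul_comm 3]
  exact h2

/-- A cycle without marked points has at least three elements. Any other has at least one, and the
weight two makes up the rest. Only an upper bound for the number of marked cycles is needed, so
several marks on one cycle do no harm. -/
theorem three_mul_numCycles_le {ι : Type} [Finite ι] (f : Perm A) (b : ι ↪ A)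
    (h : ∀ a, a ∉ Set.range b → f a ≠ a ∧ f (f (f a)) = a) :
    3 * numCycles f ≤ Nat.card A + 2 * Nat.card ι := by
  classical
  have := Fintype.ofFinite (CyclesOf f)
  have := Fintype.ofFinite ι
  have h1 : ∀ t : CyclesOf f, 3 ≤ Nat.card {a // (Quotient.mk _ a : CyclesOf f) = t} +
      2 * (if t ∈ Finset.univ.image (fun i => (Quotient.mk _ (b i) : CyclesOf f))
        then 1 else 0) := by
    rintro ⟨a⟩
    have e := card_fiber_mk f a
    change 3 ≤ Nat.card {b // (Quotient.mk _ b : CyclesOf f) = Quotient.mk _ a} + _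
    rw [e]
    split_ifs with ht
    · have : 0 < {c | SameCycle f c a}.ncard :=
        (Set.ncard_pos (Set.toFinite _)).2 ⟨a, SameCycle.refl _ _⟩
      omega
    · have ha : a ∉ Set.range b := by
        rintro ⟨i, hi⟩
        exact ht (Finset.mem_image.2 ⟨i, Finset.mem_univ _, by rw [hi]; rfl⟩)
      obtain ⟨h2, h3⟩ := h a ha
      have hsub : ({a, f a, f (f a)} : Set A) ⊆ {c | SameCycle f c a} := by
        rintro c (rfl | rfl | rfl)
        · exact SameCycle.refl _ _
        · exact sameCycle_apply_left.2 (SameCycle.refl _ _)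
        · exact sameCycle_apply_left.2 (sameCycle_apply_left.2 (SameCycle.refl _ _))
      have h4 := Set.ncard_le_ncard hsub (Set.toFinite _)
      have h5 : a ≠ f (f a) := fun e => h2 (by rw [← e] at h3; exact h3)
      have h6 : f a ≠ f (f a) := fun e => h2 (f.injective e).symm
      rw [Set.ncard_eq_three.2 ⟨a, f a, f (f a), h2.symm, h5, h6, rfl⟩] at h4
      omega
  have h2 := Finset.sum_le_sum (s := Finset.univ) fun t _ => h1 t
  rw [Finset.sum_add_distrib, ← card_eq_sum_fiber, ← Finset.mul_sum, Finset.sum_boole,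
    Finset.filter_mem_eq_inter, Finset.univ_inter] at h2
  simp only [Finset.sum_const, Finset.card_univ, smul_eq_mul] at h2
  have h3 := Finset.card_image_le (s := Finset.univ)
    (f := fun i => (Quotient.mk _ (b i) : CyclesOf f))
  rw [Finset.card_univ] at h3
  unfold numCycles
  rw [Nat.card_eq_fintype_card (α := CyclesOf f), Nat.card_eq_fintype_card (α := ι)]
  simp only [Nat.cast_id] at h2
  omega

end Count

/-! ### Disk maps as triples of permutations -/

namespace DiskMap

variable {N : ℕ}

/-- The rotation of the boundary darts. -/
noncomputable def bdryRot (G : DiskMap N) : Perm G.Dart :=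
  Perm.viaEmbedding (Equiv.subRight (1 : ZMod N)) G.bdry

theorem faceNext_eq (G : DiskMap N) : G.faceNext = G.next * G.bdryRot * G.other := rfl

theorem bdryRot_bdry (G : DiskMap N) (i : ZMod N) : G.bdryRot (G.bdry i) = G.bdry (i - 1) := by
  simp [bdryRot, Perm.viaEmbedding_apply]

theorem bdryRot_of_not_mem (G : DiskMap N) {d : G.Dart} (hd : d ∉ Set.range G.bdry) :
    G.bdryRot d = d :=
  Perm.viaEmbedding_apply_of_notMem _ _ _ hd

theorem sameCycle_bdryRot [NeZero N] (G : DiskMap N) (i : ZMod N) :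
    SameCycle G.bdryRot (G.bdry i) (G.bdry 0) := by
  have key : ∀ n : ℕ, SameCycle G.bdryRot (G.bdry n) (G.bdry 0) := by
    intro n
    induction n with
    | zero => simpa using SameCycle.refl _ _
    | succ n ih =>
      refine (sameCycle_step ?_).trans ih
      rw [bdryRot_bdry]; simp
  have := key i.val
  rwa [ZMod.natCast_zmod_val] at this

/-- The boundary darts form a single cycle, and every other dart is fixed. -/
theorem numCycles_bdryRot [NeZero N] (G : DiskMap N) :
    numCycles G.bdryRot + N = Nat.card G.Dart + 1 := by
  classical
  have := G.finite_dart
  let p : G.Dart → {d // d ∉ Set.range G.bdry} ⊕ Unit := fun d =>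
    if h : d ∈ Set.range G.bdry then Sum.inr () else Sum.inl ⟨d, h⟩
  let s : {d // d ∉ Set.range G.bdry} ⊕ Unit → G.Dart := Sum.elim (fun d => d.1)
    (fun _ => G.bdry 0)
  have key := card_cyclesOf G.bdryRot p s ?_ ?_ ?_
  · have h1 : Nat.card {d // d ∈ Set.range G.bdry} + Nat.card {d // d ∉ Set.range G.bdry} =
        Nat.card G.Dart := by
      rw [← Nat.card_sum]
      exact Nat.card_congr (Equiv.sumCompl _)
    have h2 : Nat.card {d // d ∈ Set.range G.bdry} = N := by
      rw [← Nat.card_congr (Equiv.ofInjective G.bdry G.bdry.injective), Nat.card_zmod]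
    rw [Nat.card_sum, Nat.card_unique (α := Unit)] at key
    unfold numCycles
    omega
  · intro d
    by_cases h : d ∈ Set.range G.bdry
    · obtain ⟨i, rfl⟩ := h
      rw [bdryRot_bdry]
      simp [p]
    · rw [bdryRot_of_not_mem _ h]
  · rintro (⟨d, hd⟩ | t)
    · exact dif_neg hd
    · exact dif_pos ⟨0, rfl⟩
  · intro d
    by_cases h : d ∈ Set.range G.bdry
    · have : p d = Sum.inr () := dif_pos h
      rw [this]
      obtain ⟨i, rfl⟩ := h
      exact G.sameCycle_bdryRot i
    · have : p d = Sum.inl ⟨d, h⟩ := dif_neg h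
      rw [this]
      exact SameCycle.refl _ _

theorem card_dart (G : DiskMap N) : Nat.card G.Dart = 2 * numCycles G.other :=
  haveI := G.finite_dart
  card_eq_two_mul_numCycles G.other G.other_other G.other_ne

/-- All components of the map, which need not meet the boundary, are planar, and no face is
adjacent to two components. -/
def IsPlanarMap (G : DiskMap N) : Prop := IsPlanarTriple G.next G.bdryRot G.other

theorem MeetsBoundary.numOrbits_eq_one [NeZero N] {G : DiskMap N} (hG : G.MeetsBoundary) :
    numOrbits G.next G.bdryRot G.other = 1 := by
  let s := orbitSetoid G.next G.bdryRot G.other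
  have key : ∀ d, s d (G.bdry 0) := by
    refine hG {d | s d (G.bdry 0)} ?_ ?_ ?_
    · exact fun i => sameCycle_le_setoid s (orbitSetoid_snd _ _ _) (G.sameCycle_bdryRot i)
    · exact fun d => ⟨fun h => s.trans (orbitSetoid_fst _ _ _ d) h,
        fun h => s.trans (s.symm (orbitSetoid_fst _ _ _ d)) h⟩
    · exact fun d => ⟨fun h => s.trans (orbitSetoid_trd _ _ _ d) h,
        fun h => s.trans (s.symm (orbitSetoid_trd _ _ _ d)) h⟩
  unfold numOrbits
  rw [Nat.card_eq_one_iff_unique]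
  refine ⟨⟨?_⟩, ⟨Quotient.mk _ (G.bdry 0)⟩⟩
  rintro ⟨a⟩ ⟨b⟩
  exact Quotient.sound (s.trans (key a) (s.symm (key b)))

/-- With one orbit, twice as many darts as edges and the cycle count of `bdryRot`, equality in the
genus bound becomes Euler's formula for the disk. -/
theorem MeetsBoundary.isPlanarMap_iff [NeZero N] {G : DiskMap N} (hG : G.MeetsBoundary) :
    G.IsPlanarMap ↔ G.IsPlanar := by
  have h1 := hG.numOrbits_eq_one
  have h2 := G.numCycles_bdryRot
  have h3 := G.card_dart
  unfold IsPlanarMap IsPlanarTriple totalCycles IsPlanar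
  rw [h1, ← faceNext_eq]
  unfold numCycles at *
  change _ ↔ Nat.card (CyclesOf G.next) + Nat.card (CyclesOf G.faceNext) = _
  omega

/-- The darts of the components that meet the boundary. -/
def reach (G : DiskMap N) : Set G.Dart :=
  {d | ∀ S : Set G.Dart, (∀ i, G.bdry i ∈ S) → (∀ d, G.next d ∈ S ↔ d ∈ S) →
    (∀ d, G.other d ∈ S ↔ d ∈ S) → d ∈ S}

theorem bdry_mem_reach (G : DiskMap N) (i : ZMod N) : G.bdry i ∈ G.reach :=
  fun _ h _ _ => h i

theorem next_mem_reach (G : DiskMap N) (d : G.Dart) : G.next d ∈ G.reach ↔ d ∈ G.reach :=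
  ⟨fun h S h1 h2 h3 => (h2 d).1 (h S h1 h2 h3), fun h S h1 h2 h3 => (h2 d).2 (h S h1 h2 h3)⟩

theorem other_mem_reach (G : DiskMap N) (d : G.Dart) : G.other d ∈ G.reach ↔ d ∈ G.reach :=
  ⟨fun h S h1 h2 h3 => (h3 d).1 (h S h1 h2 h3), fun h S h1 h2 h3 => (h3 d).2 (h S h1 h2 h3)⟩

theorem bdryRot_mem (G : DiskMap N) {S : Set G.Dart} (hS : ∀ i, G.bdry i ∈ S) (d : G.Dart) :
    G.bdryRot d ∈ S ↔ d ∈ S := by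
  by_cases h : d ∈ Set.range G.bdry
  · obtain ⟨i, rfl⟩ := h
    rw [bdryRot_bdry]
    exact ⟨fun _ => hS _, fun _ => hS _⟩
  · rw [bdryRot_of_not_mem _ h]

/-- The union of the components that meet the boundary. -/
noncomputable def core (G : DiskMap N) : DiskMap N where
  Dart := {d // d ∈ G.reach}
  finite_dart := haveI := G.finite_dart; inferInstance
  other := G.other.subtypePerm G.other_mem_reach
  next := G.next.subtypePerm G.next_mem_reach
  bdry := ⟨fun i => ⟨G.bdry i, G.bdry_mem_reach i⟩, fun _ _ h =>
    G.bdry.injective (congrArg Subtype.val h)⟩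
  isBlack d := G.isBlack d.1
  other_other d := Subtype.ext (G.other_other d.1)
  other_ne d h := G.other_ne d.1 (congrArg Subtype.val h)
  next_bdry i := Subtype.ext (G.next_bdry i)
  isBlack_next d := G.isBlack_next d.1

theorem core_meetsBoundary (G : DiskMap N) : G.core.MeetsBoundary := by
  intro S hb hn ho d
  -- The set `S` consists of darts of the core; its image in `G` is the invariant set to be tested
  -- against membership in `G.reach`.
  have key : d.1 ∈ {x | ∀ h : x ∈ G.reach, (⟨x, h⟩ : G.core.Dart) ∈ S} ∩ G.reach := by
    refine d.2 _ (fun i => ⟨fun _ => hb i, G.bdry_mem_reach i⟩) (fun x => ?_) (fun x => ?_)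
    · simp only [Set.mem_inter_iff, Set.mem_ofPred_eq, G.next_mem_reach]
      refine and_congr_left fun hx => ?_
      exact ⟨fun h _ => (hn ⟨x, hx⟩).1 (h hx), fun h _ => (hn ⟨x, hx⟩).2 (h hx)⟩
    · simp only [Set.mem_inter_iff, Set.mem_ofPred_eq, G.other_mem_reach]
      refine and_congr_left fun hx => ?_
      exact ⟨fun h _ => (ho ⟨x, hx⟩).1 (h hx), fun h _ => (ho ⟨x, hx⟩).2 (h hx)⟩
  exact key.1 d.2

theorem core_bdryRot (G : DiskMap N) :
    G.core.bdryRot = G.bdryRot.subtypePerm (G.bdryRot_mem G.bdry_mem_reach) := by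
  refine Equiv.ext fun d => Subtype.ext ?_
  by_cases h : d ∈ Set.range G.core.bdry
  · obtain ⟨i, rfl⟩ := h
    rw [bdryRot_bdry]
    exact (G.bdryRot_bdry i).symm
  · rw [bdryRot_of_not_mem _ h]
    refine (G.bdryRot_of_not_mem ?_).symm
    rintro ⟨i, hi⟩
    exact h ⟨i, Subtype.ext hi⟩

theorem IsPlanarMap.core {G : DiskMap N} (hG : G.IsPlanarMap) : G.core.IsPlanarMap := by
  have := G.finite_dart
  unfold IsPlanarMap
  rw [core_bdryRot]
  exact IsPlanarTriple.subtypePerm hG G.next_mem_reach (G.bdryRot_mem G.bdry_mem_reach)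
    G.other_mem_reach

end DiskMap

/-- The components of a planar map that meet the boundary form a plabic graph. -/
noncomputable def PlabicGraph.ofCore {N : ℕ} [NeZero N] (G : DiskMap N) (hG : G.IsPlanarMap) :
    PlabicGraph N where
  toDiskMap := G.core
  meetsBoundary := G.core_meetsBoundary
  isPlanar := G.core_meetsBoundary.isPlanarMap_iff.1 hG.core

/-! ### Strands and their first returns -/

namespace DiskMap

variable {N : ℕ}

/-- The turn of a strand that arrives at the base of a dart along its edge. -/
def turn (G : DiskMap N) (d : G.Dart) : G.Dart :=
  if G.isBlack d then G.next.symm d else G.next d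

theorem strandStep_eq (G : DiskMap N) (d : G.Dart) : G.strandStep d = G.turn (G.other d) := rfl

theorem isBlack_symm_next (G : DiskMap N) (d : G.Dart) :
    G.isBlack (G.next.symm d) = G.isBlack d := by
  rw [← G.isBlack_next, Equiv.apply_symm_apply]

theorem isBlack_turn (G : DiskMap N) (d : G.Dart) : G.isBlack (G.turn d) = G.isBlack d := by
  unfold turn
  split_ifs
  · exact G.isBlack_symm_next d
  · exact G.isBlack_next d

theorem turn_injective (G : DiskMap N) : Function.Injective G.turn := by
  intro d e h
  have h1 := congrArg G.isBlack h
  rw [isBlack_turn, isBlack_turn] at h1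
  unfold turn at h
  rw [h1] at h
  split_ifs at h
  · exact G.next.symm.injective h
  · exact G.next.injective h

theorem strandStep_injective (G : DiskMap N) : Function.Injective G.strandStep :=
  G.turn_injective.comp G.other.injective

theorem turn_eq_self (G : DiskMap N) {d : G.Dart} (h : G.next d = d) : G.turn d = d := by
  unfold turn
  split_ifs
  · rw [Equiv.symm_apply_eq, h]
  · exact h

theorem turn_bdry (G : DiskMap N) (i : ZMod N) : G.turn (G.bdry i) = G.bdry i :=
  G.turn_eq_self (G.next_bdry i)

theorem turn_eq_bdry_iff (G : DiskMap N) {d : G.Dart} {i : ZMod N} :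
    G.turn d = G.bdry i ↔ d = G.bdry i :=
  ⟨fun h => G.turn_injective (h.trans (G.turn_bdry i).symm), fun h => h ▸ G.turn_bdry i⟩

theorem turn_mem_bdry_iff (G : DiskMap N) {d : G.Dart} :
    G.turn d ∈ Set.range G.bdry ↔ d ∈ Set.range G.bdry :=
  exists_congr fun _ => by rw [eq_comm, turn_eq_bdry_iff, eq_comm]

/-- The turn at a boundary dart is trivial, so arrival at the boundary is visible in the iterates
themselves, one step later. The shift also excludes the starting dart. -/
theorem strandFromTo_iff (G : DiskMap N) (i j : ZMod N) :
    G.StrandFromTo i j ↔ ∃ n, (∀ m < n, G.strandStep^[m + 1] (G.bdry i) ∉ Set.range G.bdry) ∧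
      G.strandStep^[n + 1] (G.bdry i) = G.bdry j := by
  refine exists_congr fun n => and_congr (forall_congr' fun m => forall_congr' fun _ => ?_) ?_
  · rw [Function.iterate_succ_apply', strandStep_eq, turn_mem_bdry_iff]
  · rw [Function.iterate_succ_apply', strandStep_eq, turn_eq_bdry_iff]

theorem StrandFromTo.unique {G : DiskMap N} {i j k : ZMod N} (h : G.StrandFromTo i j)
    (h' : G.StrandFromTo i k) : j = k := by
  obtain ⟨n, h1, h2⟩ := h
  obtain ⟨m, h3, h4⟩ := h'
  rcases lt_trichotomy n m with h5 | rfl | h5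
  · exact absurd ⟨j, h2.symm⟩ (h3 n h5)
  · exact G.bdry.injective (h2.symm.trans h4)
  · exact absurd ⟨k, h4.symm⟩ (h1 m h5)

theorem HasStrandPerm.strandFromTo_iff {G : DiskMap N} {π : Perm (ZMod N)}
    (h : G.HasStrandPerm π) (i j : ZMod N) : G.StrandFromTo i j ↔ j = π i :=
  ⟨fun h' => h'.unique (h i), fun e => e ▸ h i⟩

/-- If the strand steps of `H` are the first returns of the strand steps of `G`, then strands of
`G` give strands of `H`. -/
theorem StrandFromTo.of_firstReturn {G H : DiskMap N} {ι : H.Dart → G.Dart}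
    (hι : Function.Injective ι) (hb : ∀ i, ι (H.bdry i) = G.bdry i)
    (hs : ∀ x, ∃ k, G.strandStep^[k + 1] (ι x) = ι (H.strandStep x) ∧
      ∀ j < k, G.strandStep^[j + 1] (ι x) ∉ Set.range ι) {i j : ZMod N}
    (h : G.StrandFromTo i j) : H.StrandFromTo i j := by
  rw [strandFromTo_iff] at h ⊢
  have key : ∀ n x, (∀ m < n, G.strandStep^[m + 1] (ι x) ∉ Set.range G.bdry) →
      G.strandStep^[n + 1] (ι x) = G.bdry j →
      ∃ n, (∀ m < n, H.strandStep^[m + 1] x ∉ Set.range H.bdry) ∧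
        H.strandStep^[n + 1] x = H.bdry j := by
    intro n
    induction n using Nat.strong_induction_on with
    | h n ih =>
      intro x h1 h2
      obtain ⟨k, h3, h4⟩ := hs x
      -- The strand of `G` cannot end before the first return, since boundary darts lie in the image
      -- of `ι`. If it ends there, one step of `H` suffices; otherwise the remaining strand is
      -- shorter.
      rcases lt_trichotomy n k with h5 | rfl | h5
      · exact absurd ⟨H.bdry j, by rw [hb, h2]⟩ (h4 n h5)
      · exact ⟨0, fun m hm => absurd hm (Nat.not_lt_zero m),
          hι (by rw [hb, ← h2, h3]; rfl)⟩
      · have h6 : ∀ m, G.strandStep^[m + 1] (ι (H.strandStep x)) =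
            G.strandStep^[m + (k + 1) + 1] (ι x) := by
          intro m
          rw [← h3, ← Function.iterate_add_apply]
          congr 1; omega
        obtain ⟨m, h7, h8⟩ := ih (n - (k + 1)) (by omega) (H.strandStep x)
          (fun m hm => by rw [h6]; exact h1 _ (by omega))
          (by rw [h6, Nat.sub_add_cancel h5, h2])
        refine ⟨m + 1, fun l hl => ?_, h8⟩
        cases l with
        | zero =>
          rintro ⟨i', hi'⟩
          exact h1 k h5 ⟨i', by rw [h3, ← hb, hi']; rfl⟩
        | succ l => exact h7 l (by omega)
  obtain ⟨n, h1, h2⟩ := h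
  rw [← hb] at h1 h2
  exact key n _ h1 h2

end DiskMap

/-! ### Minimality of the number of darts -/

namespace PlabicGraph

variable {N : ℕ}

/-- With `V` vertices, `F` faces and `D` darts, Euler's formula reads `2V + 2F = D + 2N + 2`.
Boundary vertices have degree one and all others degree three, whence `3V ≤ D + 2N`. -/
theorem six_mul_card_face_ge [NeZero N] (G : PlabicGraph N) (htri : G.IsTrivalent) :
    Nat.card G.Dart + 2 * N + 6 ≤ 6 * Nat.card G.Face := by
  have := G.finite_dart
  have h1 := three_mul_numCycles_le G.next G.bdry htri
  have h2 := G.isPlanar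
  have h3 := G.card_dart
  rw [Nat.card_zmod] at h1
  unfold DiskMap.IsPlanar at h2
  unfold numCycles at h1 h3
  omega

/-- The opposite bound on the number of vertices reverses the estimate. Degrees one and two are
admitted because the surgeries below produce them. -/
theorem six_mul_card_face_le [NeZero N] (G : PlabicGraph N)
    (h : ∀ d, G.next d = d ∨ G.next (G.next d) = d ∨ G.next (G.next (G.next d)) = d) :
    6 * Nat.card G.Face ≤ Nat.card G.Dart + 2 * N + 6 := by
  have := G.finite_dart
  have h1 := card_add_two_mul_le_of_fixed G.next h G.bdry G.next_bdry
  have h2 := G.isPlanar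
  have h3 := G.card_dart
  rw [Nat.card_zmod] at h1
  unfold DiskMap.IsPlanar at h2
  unfold numCycles at h1 h3
  omega

/-- A reduced trivalent plabic graph has the minimal number of darts among all graphs with
vertices of degree at most three and with the same strand permutation. -/
theorem IsReduced.card_dart_le [NeZero N] {G H : PlabicGraph N} (hred : G.IsReduced)
    (htri : G.IsTrivalent) {π : Perm (ZMod N)} (hG : G.HasStrandPerm π) (hH : H.HasStrandPerm π)
    (h : ∀ d, H.next d = d ∨ H.next (H.next d) = d ∨ H.next (H.next (H.next d)) = d) :
    Nat.card G.Dart ≤ Nat.card H.Dart := by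
  have h1 := hred H fun i j => by rw [hG.strandFromTo_iff, hH.strandFromTo_iff]
  have h2 := G.six_mul_card_face_ge htri
  have h3 := H.six_mul_card_face_le h
  omega

end PlabicGraph

namespace DiskMap

variable {N : ℕ}

theorem core_strandStep (G : DiskMap N) (x : G.core.Dart) :
    (G.core.strandStep x).1 = G.strandStep x.1 := by
  have h1 : ∀ y : G.core.Dart, (G.core.next.symm y).1 = G.next.symm y.1 := by
    intro y
    rw [Equiv.eq_symm_apply]
    exact congrArg Subtype.val (G.core.next.apply_symm_apply y)
  by_cases hb : G.isBlack (G.other x.1) = true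
  · exact (congrArg Subtype.val (if_pos hb)).trans ((h1 _).trans (if_pos hb).symm)
  · exact (congrArg Subtype.val (if_neg hb)).trans (if_neg hb).symm

end DiskMap

namespace PlabicGraph

variable {N : ℕ}

/-- A reduced trivalent graph cannot be replaced by the part that meets the boundary of a planar
map with fewer darts and with the same strands. -/
theorem IsReduced.false_of_firstReturn [NeZero N] {G : PlabicGraph N} (hred : G.IsReduced)
    (htri : G.IsTrivalent) {π : Perm (ZMod N)} (hperm : G.HasStrandPerm π) (H : DiskMap N)
    (hP : H.IsPlanarMap)
    (hdeg : ∀ d, H.next d = d ∨ H.next (H.next d) = d ∨ H.next (H.next (H.next d)) = d)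
    (ι : H.Dart → G.Dart) (hι : Function.Injective ι) (hb : ∀ i, ι (H.bdry i) = G.bdry i)
    (hs : ∀ x ∈ H.reach, ∃ k, G.strandStep^[k + 1] (ι x) = ι (H.strandStep x) ∧
      ∀ j < k, ∀ y ∈ H.reach, ι y ≠ G.strandStep^[j + 1] (ι x))
    (hne : ∃ d, ∀ y ∈ H.reach, ι y ≠ d) : False := by
  have := G.finite_dart
  have hinj : Function.Injective (fun x : H.core.Dart => ι x.1) :=
    fun x y hxy => Subtype.ext (hι hxy)
  have hH : (ofCore H hP).HasStrandPerm π := fun i =>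
    DiskMap.StrandFromTo.of_firstReturn (H := H.core) (ι := fun x => ι x.1) hinj hb (fun x => by
      obtain ⟨k, h1, h2⟩ := hs x.1 x.2
      exact ⟨k, by rw [H.core_strandStep]; exact h1, fun j hj ⟨y, hy⟩ => h2 j hj y.1 y.2 hy⟩) (hperm i)
  have h1 := hred.card_dart_le (H := ofCore H hP) htri hperm hH (by
    intro d
    rcases hdeg d.1 with h | h | h
    · exact Or.inl (Subtype.ext h)
    · exact Or.inr (Or.inl (Subtype.ext h))
    · exact Or.inr (Or.inr (Subtype.ext h)))
  obtain ⟨d, hd⟩ := hne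
  have h2 : Set.range (fun x : H.core.Dart => ι x.1) ⊂ Set.univ :=
    Set.ssubset_univ_iff.2 fun h => by
      obtain ⟨y, hy⟩ := Set.range_eq_univ.1 h d
      exact hd y.1 y.2 hy
  have h3 := Set.ncard_lt_ncard h2 (Set.toFinite _)
  rw [Set.ncard_univ, Set.ncard_range_of_injective hinj] at h3
  exact absurd h1 (not_le.2 h3)

end PlabicGraph

/-- An injective self-map of a finite type makes `d` periodic. Since the path has to return to `d`,
outside `I`, it cannot stay in `I` forever and must pass through `C`. -/
theorem Function.Injective.exists_exit {A : Type} [Finite A] {f : A → A}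
    (hf : Function.Injective f) {I C : Set A} (hstep : ∀ z ∈ I, z ∉ C → f z ∈ I) {d : A}
    (hd : d ∉ I) (hfd : f d ∈ I) :
    ∃ k, f^[k + 1] d ∈ C ∧ ∀ j < k, f^[j + 1] d ∈ I ∧ f^[j + 1] d ∉ C := by
  classical
  have hex : ∃ k, f^[k + 1] d ∈ C := by
    by_contra! h
    have h1 : ∀ k, f^[k + 1] d ∈ I := by
      intro k
      induction k with
      | zero => exact hfd
      | succ k ih => rw [Function.iterate_succ_apply']; exact hstep _ ih (h k)
    obtain ⟨p, hp, hpd⟩ := hf.mem_periodicPts d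
    -- The claim counts from the first step, so the index `p - 1` stands for the whole period.
    have h2 := h1 (p - 1)
    rw [Nat.sub_add_cancel hp] at h2
    exact hd (hpd.eq ▸ h2)
  have hmin : ∀ j < Nat.find hex, f^[j + 1] d ∉ C := fun j hj => Nat.find_min hex hj
  refine ⟨Nat.find hex, Nat.find_spec hex, fun j hj => ⟨?_, hmin j hj⟩⟩
  induction j with
  | zero => exact hfd
  | succ j ih =>
    rw [Function.iterate_succ_apply']
    exact hstep _ (ih (by omega)) (hmin j (by omega))

/-! ### Surgery on rotations and pairings -/

namespace DiskMap

variable {N : ℕ}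

/-- A map with a different rotation of the darts. -/
def withNext (G : DiskMap N) (n : Perm G.Dart) (hb : ∀ i, n (G.bdry i) = G.bdry i)
    (hc : ∀ d, G.isBlack (n d) = G.isBlack d) : DiskMap N :=
  { G with next := n, next_bdry := hb, isBlack_next := hc }

/-- A map with a different pairing of the darts. -/
def withOther (G : DiskMap N) (o : Perm G.Dart) (ho : ∀ d, o (o d) = d)
    (hne : ∀ d, o d ≠ d) : DiskMap N :=
  { G with other := o, other_other := ho, other_ne := hne }

end DiskMap

/-- The permutation obtained by removing an element from its cycle. -/
def Equiv.Perm.detach {A : Type} [DecidableEq A] (f : Perm A) (c : A) : Perm A :=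
  swap c (f c) * f

section Detach

variable {A : Type} [DecidableEq A] (f : Perm A) (c : A)

theorem detach_self : f.detach c c = c := swap_apply_right _ _

theorem detach_of_apply_eq {z : A} (hz : f z = c) : f.detach c z = f c := by
  unfold Perm.detach
  rw [Perm.mul_apply, hz, swap_apply_left]

theorem detach_of_ne {z : A} (h : z ≠ c) (hz : f z ≠ c) : f.detach c z = f z :=
  swap_apply_of_ne_of_ne hz fun e => h (f.injective e)

theorem detach_of_fixed {z : A} (h : f z = z) : f.detach c z = z := by
  by_cases hz : z = c
  · rw [hz, detach_self]
  · rw [detach_of_ne f c hz (by rwa [h]), h]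

/-- Taking an element out of a cycle shortens that cycle by one, so cycles of length at most three
stay so. -/
theorem detach_cube (h : ∀ z, f z = z ∨ f (f z) = z ∨ f (f (f z)) = z) (z : A) :
    f.detach c z = z ∨ f.detach c (f.detach c z) = z ∨
      f.detach c (f.detach c (f.detach c z)) = z := by
  by_cases hz : z = c
  · left; rw [hz, detach_self]
  by_cases h0 : f z = c
  · have e : f.detach c z = f (f z) := by rw [detach_of_apply_eq f c h0, h0]
    rcases h z with h1 | h1 | h1
    · exact absurd (h1.symm.trans h0) hz
    · left; rw [e, h1]
    · right; left
      rw [e, detach_of_ne f c ?_ (by rw [h1]; exact hz), h1]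
      intro h2
      exact hz (f.injective (by rw [h0] at h2; rw [h0, h2]))
  have e : f.detach c z = f z := detach_of_ne f c hz h0
  rcases h z with h1 | h1 | h1
  · left; rw [e, h1]
  · right; left
    rw [e, detach_of_ne f c h0 (by rw [h1]; exact hz), h1]
  · right
    by_cases h2 : f (f z) = c
    · left; rw [e, detach_of_apply_eq f c h2, ← h2, h1]
    · right; rw [e, detach_of_ne f c h0 h2, detach_of_ne f c h2 (by rw [h1]; exact hz), h1]

theorem detach_mem_iff {S : Set A} (hS : ∀ z, f z ∈ S ↔ z ∈ S) (z : A) :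
    f.detach c z ∈ S ↔ z ∈ S := by
  by_cases hz : z = c
  · rw [hz, detach_self]
  by_cases h0 : f z = c
  · rw [detach_of_apply_eq f c h0, ← h0, hS, hS]
  · rw [detach_of_ne f c hz h0, hS]

theorem detach_of_not_mem {S : Set A} (hS : ∀ z, f z ∈ S ↔ z ∈ S) (hc : c ∈ S) {z : A}
    (hz : z ∉ S) : f.detach c z = f z :=
  detach_of_ne f c (fun e => hz (e ▸ hc)) (fun e => hz ((hS z).1 (e ▸ hc)))

end Detach

/-! ### Excision of an inner part -/

namespace PlabicGraph

variable {N : ℕ} [NeZero N] {G : PlabicGraph N} {π : Perm (ZMod N)}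

theorem next_mem_compl {N : ℕ} {G : PlabicGraph N} {I : Set G.Dart} (hn : ∀ d, G.next d ∈ I ↔ d ∈ I) (d : G.Dart) :
    G.next d ∈ Iᶜ ↔ d ∈ Iᶜ := not_congr (hn d)

theorem turn_mem {N : ℕ} {G : PlabicGraph N} {I : Set G.Dart} (hn : ∀ d, G.next d ∈ I ↔ d ∈ I) (d : G.Dart) :
    G.turn d ∈ I ↔ d ∈ I := by
  unfold DiskMap.turn
  split_ifs
  · rw [← hn, Equiv.apply_symm_apply]
  · exact hn d

/-- In a reduced trivalent graph, a part `I` joined to the rest by edges with inner darts in `C`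
cannot be cut off if each strand that enters `I` leaves it along the same edge. -/
theorem IsReduced.false_of_turn_back (hred : G.IsReduced) (htri : G.IsTrivalent)
    (hperm : G.HasStrandPerm π) {I C : Set G.Dart} (hb : ∀ i, G.bdry i ∉ I)
    (hn : ∀ d, G.next d ∈ I ↔ d ∈ I)
    (hC : ∀ d ∈ I, G.other d ∉ I → d ∈ C) (hne : ∃ d ∈ I, d ∉ C)
    (n : Perm G.Dart) (hcol : ∀ d, G.isBlack (n d) = G.isBlack d)
    (hP : IsPlanarTriple n G.bdryRot G.other)
    (hdeg : ∀ d, n d = d ∨ n (n d) = d ∨ n (n (n d)) = d) (hout : ∀ d ∉ I, n d = G.next d)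
    (hfix : ∀ c ∈ C, n c = c)
    (hexit : ∀ c ∈ C, G.other c ∉ I ∧ ∃ k, G.strandStep^[k + 1] (G.other c) = c ∧
      ∀ j < k, G.strandStep^[j + 1] (G.other c) ∈ I ∧ G.strandStep^[j + 1] (G.other c) ∉ C) :
    False := by
  have hnb : ∀ i, n (G.bdry i) = G.bdry i := fun i => (hout _ (hb i)).trans (G.next_bdry i)
  let H : DiskMap N := G.withNext n hnb hcol
  have hnI : ∀ d, n d ∈ I ↔ d ∈ I := by
    intro d
    constructor
    · intro h1
      by_contra h2
      rw [hout d h2, hn] at h1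
      exact h2 h1
    · intro h1
      by_contra h2
      obtain ⟨z, hz⟩ := G.next.surjective (n d)
      have hzI : z ∉ I := fun h => h2 (hz ▸ (hn z).2 h)
      rw [← hout z hzI] at hz
      exact hzI (n.injective hz ▸ h1)
  -- Each dart of `C` is now the only one at its vertex, so nothing in `I` beyond it is connected to
  -- the boundary.
  have hreach : H.reach ⊆ {d | d ∈ I → d ∈ C} := by
    refine fun d hd => hd _ (fun i h => absurd h (hb i)) (fun (z : G.Dart) => ?_)
      (fun (z : G.Dart) => ?_)
    · change (n z ∈ I → n z ∈ C) ↔ (z ∈ I → z ∈ C)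
      by_cases hz : z ∈ I
      · have hz' := (hnI z).2 hz
        simp only [hz, hz', true_imp_iff]
        constructor
        · intro h
          have := hfix _ h
          rwa [← n.injective this]
        · intro h
          rwa [hfix z h]
      · have hz' := mt (hnI z).1 hz
        simp [hz, hz']
    · change (G.other z ∈ I → G.other z ∈ C) ↔ (z ∈ I → z ∈ C)
      have key : ∀ z, (z ∈ I → z ∈ C) → (G.other z ∈ I → G.other z ∈ C) := by
        intro z h1 h2
        by_cases hz : z ∈ I
        · exact absurd h2 (hexit z (h1 hz)).1
        · exact hC _ h2 (by rwa [G.other_other])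
      refine ⟨fun h => ?_, key z⟩
      have := key _ h
      rwa [G.other_other] at this
  refine hred.false_of_firstReturn htri hperm H hP hdeg (fun d => d) (fun _ _ h => h)
    (fun _ => rfl) ?_ ?_
  · intro x hx
    change G.Dart at x
    change ∃ k, G.strandStep^[k + 1] x = H.turn (G.other x) ∧ _
    have hox := hreach ((H.other_mem_reach x).2 hx)
    change G.other x ∈ I → G.other x ∈ C at hox
    -- On entering `I` the new strand turns back at a vertex of degree one. The strand of `G` comes
    -- to the same dart after an excursion through darts that are no longer reached.
    by_cases h : G.other x ∈ I
    · obtain ⟨-, k, h1, h2⟩ := hexit _ (hox h)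
      rw [G.other_other] at h1 h2
      refine ⟨k, by rw [h1]; exact (H.turn_eq_self (hfix _ (hox h))).symm, fun j hj y hy e => ?_⟩
      exact (h2 j hj).2 (e ▸ hreach hy (e ▸ (h2 j hj).1))
    · refine ⟨0, ?_, fun j hj => absurd hj (Nat.not_lt_zero j)⟩
      change G.turn (G.other x) = H.turn (G.other x)
      unfold DiskMap.turn
      change _ = if G.isBlack (G.other x) then n.symm (G.other x) else n (G.other x)
      rw [hout _ h]
      congr 1
      rw [Equiv.eq_symm_apply, hout, Equiv.apply_symm_apply]
      rwa [← hn, Equiv.apply_symm_apply]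
  · obtain ⟨d, h1, h2⟩ := hne
    exact ⟨d, fun y hy e => h2 (e ▸ hreach hy (e ▸ h1))⟩

/-- In a reduced trivalent graph, a part `I` cannot be bypassed by joining the edges that lead to
it in the way the strands pass through `I`. -/
theorem IsReduced.false_of_bypass (hred : G.IsReduced) (htri : G.IsTrivalent)
    (hperm : G.HasStrandPerm π) {I : Set G.Dart} (hb : ∀ i, G.bdry i ∉ I)
    (hn : ∀ d, G.next d ∈ I ↔ d ∈ I) (hne : I.Nonempty)
    (o : Perm G.Dart) (ho : ∀ d, o (o d) = d) (hod : ∀ d, o d ≠ d)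
    (hP : IsPlanarTriple G.next G.bdryRot o) (hoI : ∀ d, o d ∈ I ↔ d ∈ I)
    (hs : ∀ d ∉ I, o d = G.other d ∨ ∃ k, G.strandStep^[k + 1] d = G.other (o d) ∧
      ∀ j < k + 1, G.strandStep^[j + 1] d ∈ I) :
    False := by
  let H : DiskMap N := G.withOther o ho hod
  have hreach : H.reach ⊆ Iᶜ := by
    exact fun d hd => hd _ hb (next_mem_compl hn) (fun z => not_congr (hoI z))
  refine hred.false_of_firstReturn htri hperm H hP ?_ (fun d => d) (fun _ _ h => h)
    (fun _ => rfl) ?_ ?_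
  · intro d
    change G.next d = d ∨ G.next (G.next d) = d ∨ G.next (G.next (G.next d)) = d
    by_cases h : d ∈ Set.range G.bdry
    · obtain ⟨i, rfl⟩ := h
      exact Or.inl (G.next_bdry i)
    · exact Or.inr (Or.inr (htri d h).2)
  · intro x hx
    change G.Dart at x
    change ∃ k, G.strandStep^[k + 1] x = G.turn (o x) ∧ _
    rcases hs x (hreach hx) with h | ⟨k, h1, h2⟩
    · exact ⟨0, by rw [h]; rfl, fun j hj => absurd hj (Nat.not_lt_zero j)⟩
    -- The dart `G.other (o x)` is the one on which the strand leaves `I`. A further step traverses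
    -- it and turns at the base of `o x`, where the new strand arrives at once.
    · refine ⟨k + 1, ?_, fun j hj y hy e => hreach hy (e ▸ h2 j hj)⟩
      rw [Function.iterate_succ_apply', h1, DiskMap.strandStep_eq, G.other_other]
  · obtain ⟨d, hd⟩ := hne
    exact ⟨d, fun y hy e => hreach hy (e ▸ hd)⟩

end PlabicGraph

/-! ### Edges with the same face on both sides -/

namespace DiskMap

variable {N : ℕ}

theorem leftFace_eq_iff (G : DiskMap N) {d e : G.Dart} :
    G.leftFace d = G.leftFace e ↔ SameCycle G.faceNext d e := Quotient.eq

theorem leftFace_faceNext (G : DiskMap N) (d : G.Dart) :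
    G.leftFace (G.faceNext d) = G.leftFace d := mk_apply_eq _ _

/-- The face walk that arrives at the base of `d` along its edge turns left onto `G.next d`. -/
theorem leftFace_next (G : DiskMap N) {d : G.Dart} (hd : d ∉ Set.range G.bdry) :
    G.leftFace (G.next d) = G.leftFace (G.other d) := by
  rw [← G.leftFace_faceNext (G.other d)]
  congr 1
  exact (G.faceNext_of_eq (G.other_other d) hd).symm

theorem isBlack_detach (G : DiskMap N) {n : Perm G.Dart}
    [DecidableEq G.Dart] (hn : ∀ d, G.isBlack (n d) = G.isBlack d) (c d : G.Dart) :
    G.isBlack (n.detach c d) = G.isBlack d :=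
  (detach_mem_iff n c (S := {y | G.isBlack y = G.isBlack d})
    (fun z => by change G.isBlack (n z) = _ ↔ _; rw [hn]; rfl) d).2 rfl

/-- The two sides of an edge that joins two boundary vertices belong to different faces. -/
theorem leftFace_ne_of_bdry [NeZero N] {G : DiskMap N} (hG : G.MeetsBoundary)
    (hP : G.IsPlanarMap) {i j : ZMod N} (h : G.other (G.bdry i) = G.bdry j) :
    G.leftFace (G.bdry i) ≠ G.leftFace (G.bdry j) := by
  classical
  intro hL
  have := G.finite_dart
  have hne : G.bdry i ≠ G.bdry j := fun e => G.other_ne _ (h.trans e.symm)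
  have h' : G.other (G.bdry j) = G.bdry i := by rw [← h, G.other_other]
  let s := swap (G.bdry i) (G.bdry j)
  have h1 := numCycles_mul_swap_of_sameCycle G.bdryRot hne
    ((G.sameCycle_bdryRot i).trans (G.sameCycle_bdryRot j).symm)
  have h2 := numCycles_mul_swap_of_sameCycle G.faceNext hne (G.leftFace_eq_iff.1 hL)
  -- The pairing exchanges the two darts, so it commutes with their transposition, which can thus be
  -- absorbed into the boundary rotation.
  have h3 : G.faceNext * s = G.next * (G.bdryRot * s) * G.other := by
    rw [faceNext_eq, mul_assoc, mul_swap_eq, h, h', swap_comm]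
    simp only [mul_assoc]
    rfl
  have h4 := totalCycles_le G.next (G.bdryRot * s) G.other
  -- The edge still connects the two darts, so no orbit is gained, although two cycles are. This
  -- contradicts the genus bound.
  have h5 : numOrbits G.next (G.bdryRot * s) G.other ≤ numOrbits G.next G.bdryRot G.other := by
    let t := orbitSetoid G.next (G.bdryRot * s) G.other
    refine card_quotient_le fun a b hab => orbitSetoid_le (t := t)
      (orbitSetoid_fst _ _ _) (fun x => ?_) (orbitSetoid_trd _ _ _) hab
    have h6 : ∀ x, t x (s x) := by
      intro x
      by_cases hx : x = G.bdry i
      · rw [hx, swap_apply_left, ← h]; exact orbitSetoid_trd _ _ _ _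
      by_cases hy : x = G.bdry j
      · rw [hy, swap_apply_right, ← h']; exact orbitSetoid_trd _ _ _ _
      rw [swap_apply_of_ne_of_ne hx hy]
    have h7 : t (s x) ((G.bdryRot * s) (s x)) := orbitSetoid_snd _ _ _ _
    rw [Perm.mul_apply, swap_apply_self] at h7
    exact t.trans (h6 x) h7
  have h6 := hG.numOrbits_eq_one
  change numCycles (G.faceNext * s) = _ at h2
  change numCycles (G.bdryRot * s) = _ at h1
  rw [h3] at h2
  unfold IsPlanarMap IsPlanarTriple at hP
  unfold totalCycles at *
  rw [faceNext_eq] at h2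
  omega

end DiskMap

namespace PlabicGraph

variable {N : ℕ} [NeZero N] {G : PlabicGraph N} {π : Perm (ZMod N)}

theorem isPlanarMap (G : PlabicGraph N) : G.IsPlanarMap :=
  G.meetsBoundary.isPlanarMap_iff.2 G.isPlanar

theorem next_cube_of_isTrivalent (htri : G.IsTrivalent) (d : G.Dart) :
    G.next d = d ∨ G.next (G.next d) = d ∨ G.next (G.next (G.next d)) = d := by
  by_cases h : d ∈ Set.range G.bdry
  · obtain ⟨i, rfl⟩ := h
    exact Or.inl (G.next_bdry i)
  · exact Or.inr (Or.inr (htri d h).2)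

/-- No edge of a reduced trivalent graph cuts off an inner part. -/
theorem IsReduced.false_of_cut_edge (hred : G.IsReduced) (htri : G.IsTrivalent)
    (hperm : G.HasStrandPerm π) {I : Set G.Dart} (hb : ∀ i, G.bdry i ∉ I)
    (hn : ∀ d, G.next d ∈ I ↔ d ∈ I) {c : G.Dart} (hc : c ∈ I) (hoc : G.other c ∉ I)
    (ho : ∀ d ∈ I, d ≠ c → G.other d ∈ I) : False := by
  classical
  have := G.finite_dart
  have hcb : c ∉ Set.range G.bdry := by rintro ⟨i, rfl⟩; exact hb i hc
  refine hred.false_of_turn_back htri hperm hb hn (C := {c}) ?_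
    ⟨G.next c, (hn c).2 hc, (htri c hcb).1⟩ (Perm.detach G.next c)
    (G.isBlack_detach G.isBlack_next c)
    (IsPlanarTriple.swap_mul G.isPlanarMap (DiskMap.sameCycle_step rfl))
    (detach_cube _ _ (next_cube_of_isTrivalent htri)) (fun d hd => detach_of_not_mem _ _ hn hc hd) ?_ ?_
  · intro d hd h
    by_contra h1
    exact h (ho d hd h1)
  · rintro _ rfl
    exact detach_self _ _
  · rintro _ rfl
    refine ⟨hoc, ?_⟩
    refine G.strandStep_injective.exists_exit (I := I) (C := {_}) (fun z hz hzc => ?_) hoc ?_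
    · rw [DiskMap.strandStep_eq, turn_mem hn]
      exact ho z hz hzc
    · rw [DiskMap.strandStep_eq, turn_mem hn, G.other_other]
      exact hc

/-- The two sides of an edge of a reduced trivalent graph belong to different faces. -/
theorem IsReduced.leftFace_ne (hred : G.IsReduced) (htri : G.IsTrivalent)
    (hperm : G.HasStrandPerm π) (d : G.Dart) : G.leftFace d ≠ G.leftFace (G.other d) := by
  classical
  have := G.finite_dart
  have key : ∀ c, c ∉ Set.range G.bdry → G.leftFace c ≠ G.leftFace (G.other c) := by
    intro c hcb hL
    have hnc := (htri c hcb).1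
    -- A face on both sides of the edge contains both `c` and `G.next c`, so detaching `c` from its
    -- vertex disconnects the map.
    obtain ⟨-, h2⟩ := IsPlanarTriple.swap_mul_of_sameCycle G.isPlanarMap hnc.symm
      (DiskMap.sameCycle_step rfl)
      (G.leftFace_eq_iff.1 (hL.trans (G.leftFace_next hcb).symm))
    let H : DiskMap N := G.withNext (Perm.detach G.next c)
      (fun i => detach_of_fixed _ _ (G.next_bdry i)) (G.isBlack_detach G.isBlack_next c)
    obtain ⟨R, hR, hRn, hRo, hRb⟩ : ∃ R : Set G.Dart, (¬ ∀ d, d ∈ R) ∧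
        (∀ z, Perm.detach G.next c z ∈ R ↔ z ∈ R) ∧ (∀ z, G.other z ∈ R ↔ z ∈ R) ∧
        ∀ i, G.bdry i ∈ R := by
      refine ⟨H.reach, fun h => ?_, H.next_mem_reach, H.other_mem_reach, H.bdry_mem_reach⟩
      have h3 : H.MeetsBoundary := fun S h1 h2 h3 d => h d S h1 h2 h3
      have h4 := h3.numOrbits_eq_one
      rw [G.meetsBoundary.numOrbits_eq_one] at h2
      exact absurd (h4.symm.trans h2) (by omega)
    -- Otherwise `R` would stay invariant when `c` is put back, contrary to connectedness.
    have hiff : ¬ (c ∈ R ↔ G.next c ∈ R) := by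
      intro hiff
      refine hR (G.meetsBoundary R hRb (fun z => ?_) hRo)
      by_cases hz : z = c
      · rw [hz]; exact hiff.symm
      by_cases h0 : G.next z = c
      · rw [h0, hiff, ← hRn z, detach_of_apply_eq _ _ h0]
      · rw [← hRn z, detach_of_ne _ _ hz h0]
    by_cases hcR : c ∈ R
    · have hncR : G.next c ∉ R := fun h => hiff ⟨fun _ => h, fun _ => hcR⟩
      -- The remainder of the vertex is cut off. The dart `c` is counted with it, so that the inner
      -- part is a union of vertices.
      refine hred.false_of_cut_edge htri hperm (I := (R \ {c})ᶜ) (c := c) ?_ ?_ ?_ ?_ ?_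
      · exact fun i h => h ⟨hRb i, fun e => hcb ⟨i, e⟩⟩
      · refine fun z => not_congr ?_
        simp only [Set.mem_sdiff, Set.mem_singleton_iff]
        by_cases hz : z = c
        · simp [hz, hncR]
        by_cases h0 : G.next z = c
        · have := hRn z
          rw [detach_of_apply_eq _ _ h0] at this
          simp [h0, ← this, hncR]
        · rw [← hRn z, detach_of_ne _ _ hz h0]; simp [hz, h0]
      · exact fun h => h.2 rfl
      · exact fun h => h ⟨(hRo c).2 hcR, G.other_ne c⟩
      · rintro z hz hzc ⟨h1, -⟩
        exact hz ⟨(hRo z).1 h1, hzc⟩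
    · have hncR : G.next c ∈ R := by
        by_contra h
        exact hiff ⟨fun h' => absurd h' hcR, fun h' => absurd h' h⟩
      -- Here the edge is cut off together with `c`. The dart `c` is returned to its vertex outside,
      -- and `G.other c` is the inner end.
      refine hred.false_of_cut_edge htri hperm (I := (R ∪ {c})ᶜ) (c := G.other c) ?_ ?_ ?_ ?_ ?_
      · exact fun i h => h (Or.inl (hRb i))
      · refine fun z => not_congr ?_
        simp only [Set.mem_union, Set.mem_singleton_iff]
        by_cases hz : z = c
        · simp [hz, hncR]
        by_cases h0 : G.next z = c
        · have := hRn z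
          rw [detach_of_apply_eq _ _ h0] at this
          simp [h0, ← this, hncR]
        · rw [← hRn z, detach_of_ne _ _ hz h0]; simp [hz, h0]
      · rintro (h | h)
        · exact hcR ((hRo c).1 h)
        · exact G.other_ne c h
      · rw [G.other_other]
        exact fun h => h (Or.inr rfl)
      · rintro z hz hzc (h1 | h1)
        · exact hz (Or.inl ((hRo z).1 h1))
        · exact hzc (by rw [← (h1 : G.other z = c), G.other_other])
  by_cases h1 : d ∈ Set.range G.bdry
  · by_cases h2 : G.other d ∈ Set.range G.bdry
    · obtain ⟨i, rfl⟩ := h1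
      obtain ⟨j, hj⟩ := h2
      rw [← hj]
      exact DiskMap.leftFace_ne_of_bdry G.meetsBoundary G.isPlanarMap hj.symm
    · have := key _ h2
      rw [G.other_other] at this
      exact this.symm
  · exact key d h1

end PlabicGraph

/-! ### Pairs of edges between the same two faces -/

namespace PlabicGraph

variable {N : ℕ} [NeZero N] {G : PlabicGraph N} {π : Perm (ZMod N)}

/-- No two edges of a reduced trivalent graph cut off an inner part. -/
theorem IsReduced.false_of_two_edge_cut (hred : G.IsReduced) (htri : G.IsTrivalent)
    (hperm : G.HasStrandPerm π) {I : Set G.Dart} (hb : ∀ i, G.bdry i ∉ I)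
    (hn : ∀ d, G.next d ∈ I ↔ d ∈ I) {d₁ d₂ : G.Dart} (hne : d₁ ≠ d₂)
    (h₁ : d₁ ∉ I) (h₂ : d₂ ∉ I) (hc₁ : G.other d₁ ∈ I) (hc₂ : G.other d₂ ∈ I)
    (hI : ∀ d ∈ I, d ≠ G.other d₁ → d ≠ G.other d₂ → G.other d ∈ I)
    (o : Perm G.Dart) (ho : ∀ d, o (o d) = d) (hod : ∀ d, o d ≠ d) (ho₁ : o d₁ = d₂)
    (hoc : o (G.other d₁) = G.other d₂)
    (hoo : ∀ d, d ≠ d₁ → d ≠ d₂ → d ≠ G.other d₁ → d ≠ G.other d₂ → o d = G.other d)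
    (hP : IsPlanarTriple G.next G.bdryRot o) : False := by
  classical
  have := G.finite_dart
  let C : Set G.Dart := {G.other d₁, G.other d₂}
  have ho₂ : o d₂ = d₁ := by rw [← ho₁, ho]
  have hoc' : o (G.other d₂) = G.other d₁ := by rw [← hoc, ho]
  have hcne : G.other d₁ ≠ G.other d₂ := fun e => hne (G.other.injective e)
  have hIC : ∀ d ∈ I, d ∉ C → G.other d ∈ I := fun d hd hC =>
    hI d hd (fun e => hC (Or.inl e)) (fun e => hC (Or.inr e))
  have hstep : ∀ z ∈ I, z ∉ C → G.strandStep z ∈ I := by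
    intro z hz hzc
    rw [DiskMap.strandStep_eq, turn_mem hn]
    exact hIC z hz hzc
  have hstart : ∀ d, G.other d ∈ I → G.strandStep d ∈ I := by
    intro d hd
    rwa [DiskMap.strandStep_eq, turn_mem hn]
  obtain ⟨k₁, hk₁, hj₁⟩ := G.strandStep_injective.exists_exit hstep h₁ (hstart _ hc₁)
  obtain ⟨k₂, hk₂, hj₂⟩ := G.strandStep_injective.exists_exit hstep h₂ (hstart _ hc₂)
  -- Equal exits can be traced back to the start of the shorter path. This lies outside `I`, while
  -- the longer path is then inside; for equal lengths the starts would agree.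
  have key : ∀ (x y : G.Dart) (k l : ℕ), x ∉ I → x ≠ y → k ≤ l →
      (∀ j < l, G.strandStep^[j + 1] y ∈ I ∧ G.strandStep^[j + 1] y ∉ C) →
      G.strandStep^[k + 1] x ≠ G.strandStep^[l + 1] y := by
    intro x y k l hx hxy hkl hj e
    have e1 : l + 1 = (k + 1) + (l - k) := by omega
    rw [e1, Function.iterate_add_apply G.strandStep (k + 1) (l - k)] at e
    have e2 := G.strandStep_injective.iterate _ e
    rcases Nat.eq_zero_or_pos (l - k) with h0 | h0
    · rw [h0] at e2; exact hxy e2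
    · have := (hj (l - k - 1) (by omega)).1
      rw [Nat.sub_add_cancel h0, ← e2] at this
      exact hx this
  have hdiff : G.strandStep^[k₁ + 1] d₁ ≠ G.strandStep^[k₂ + 1] d₂ := by
    rcases le_total k₁ k₂ with h | h
    · exact key _ _ _ _ h₁ hne h hj₂
    · exact (key _ _ _ _ h₂ hne.symm h hj₁).symm
  have hbd : ∀ d ∈ I, d ∉ Set.range G.bdry := by rintro _ hd ⟨i, rfl⟩; exact hb i hd
  -- The two exits are distinct, so either both strands turn back or they exchange the two edges. In
  -- the first case both edges receive ends of degree one.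
  by_cases hcase : G.strandStep^[k₁ + 1] d₁ = G.other d₁
  · have hcase₂ : G.strandStep^[k₂ + 1] d₂ = G.other d₂ :=
      hk₂.resolve_left fun e => hdiff (hcase.trans e.symm)
    let n := Perm.detach (Perm.detach G.next (G.other d₁)) (G.other d₂)
    refine hred.false_of_turn_back htri hperm hb hn (C := C) ?_ ?_ n
      (G.isBlack_detach (G.isBlack_detach G.isBlack_next _) _)
      (IsPlanarTriple.swap_mul (IsPlanarTriple.swap_mul G.isPlanarMap
        (DiskMap.sameCycle_step rfl)) (DiskMap.sameCycle_step rfl))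
      (detach_cube _ _ (detach_cube _ _ (next_cube_of_isTrivalent htri))) ?_ ?_ ?_
    · intro d hd h
      by_contra h1
      exact h (hIC d hd h1)
    -- A vertex of degree three has a dart outside the two-element set `C`.
    · obtain ⟨a1, a2⟩ := htri _ (hbd _ hc₁)
      obtain ⟨b1, b2⟩ := htri _ (hbd _ hc₂)
      by_cases e : G.next (G.other d₁) = G.other d₂
      · refine ⟨G.next (G.other d₂), (hn _).2 hc₂, ?_⟩
        rintro (h | h)
        · rw [← e] at h
          rw [h] at a2
          exact a1 a2
        · exact b1 h
      · refine ⟨G.next (G.other d₁), (hn _).2 hc₁, ?_⟩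
        rintro (h | h)
        · exact a1 h
        · exact e h
    · intro d hd
      rw [← detach_of_not_mem _ (G.other d₁) hn hc₁ hd]
      exact detach_of_not_mem _ _ (detach_mem_iff _ _ hn) hc₂ hd
    · rintro _ (rfl | rfl)
      · exact detach_of_fixed _ _ (detach_self _ _)
      · exact detach_self _ _
    · rintro _ (rfl | rfl)
      · rw [G.other_other]; exact ⟨h₁, k₁, hcase, hj₁⟩
      · rw [G.other_other]; exact ⟨h₂, k₂, hcase₂, hj₂⟩
  -- In the second case the pairing `o` joins the two edges directly.
  · have hcase₁ : G.strandStep^[k₁ + 1] d₁ = G.other d₂ := hk₁.resolve_left hcase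
    have hcase₂ : G.strandStep^[k₂ + 1] d₂ = G.other d₁ :=
      hk₂.resolve_right fun e => hdiff (hcase₁.trans e.symm)
    refine hred.false_of_bypass htri hperm hb hn ⟨_, hc₁⟩ o ho hod hP (fun d => ?_) (fun d hd => ?_)
    · have hfw : ∀ d ∈ I, o d ∈ I := by
        intro d hd
        by_cases e1 : d = G.other d₁
        · rw [e1, hoc]; exact hc₂
        by_cases e2 : d = G.other d₂
        · rw [e2, hoc']; exact hc₁
        rw [hoo d (fun e => h₁ (e ▸ hd)) (fun e => h₂ (e ▸ hd)) e1 e2]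
        exact hI d hd e1 e2
      exact ⟨fun h => by have := hfw _ h; rwa [ho] at this, hfw d⟩
    · have last : ∀ (x : G.Dart) (k : ℕ), G.strandStep^[k + 1] x ∈ I →
          (∀ j < k, G.strandStep^[j + 1] x ∈ I ∧ G.strandStep^[j + 1] x ∉ C) →
          ∀ j < k + 1, G.strandStep^[j + 1] x ∈ I := by
        intro x k hk hj j hjk
        rcases Nat.lt_succ_iff_lt_or_eq.1 hjk with h | rfl
        · exact (hj j h).1
        · exact hk
      by_cases e1 : d = d₁
      · subst e1
        exact Or.inr ⟨k₁, by rw [hcase₁, ho₁], last _ _ (hcase₁ ▸ hc₂) hj₁⟩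
      by_cases e2 : d = d₂
      · subst e2
        exact Or.inr ⟨k₂, by rw [hcase₂, ho₂], last _ _ (hcase₂ ▸ hc₁) hj₂⟩
      exact Or.inl (hoo d e1 e2 (fun e => hd (e ▸ hc₁)) (fun e => hd (e ▸ hc₂)))

/-- Two different edges of a reduced trivalent graph do not lie between the same two faces. -/
theorem IsReduced.eq_other_of_leftFace_eq (hred : G.IsReduced) (htri : G.IsTrivalent)
    (hperm : G.HasStrandPerm π) {d₁ d₂ : G.Dart}
    (h1 : G.leftFace d₁ = G.leftFace (G.other d₂))
    (h2 : G.leftFace (G.other d₁) = G.leftFace d₂) : d₂ = G.other d₁ := by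
  classical
  by_contra hne
  have := G.finite_dart
  have hL := hred.leftFace_ne htri hperm
  have hd : d₁ ≠ d₂ := by rintro rfl; exact hL _ h1
  have hd1 : d₁ ≠ G.other d₁ := (G.other_ne _).symm
  have hd2 : d₂ ≠ G.other d₂ := (G.other_ne _).symm
  have hd3 : d₁ ≠ G.other d₂ := fun e => hne (by rw [e, G.other_other])
  have hc : G.other d₁ ≠ G.other d₂ := fun e => hd (G.other.injective e)
  -- Both edges are cut along a closed curve through the two faces, and their halves are rejoined on
  -- either side of it: `d₁` with `d₂`, and `G.other d₁` with `G.other d₂`.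
  let o : Perm G.Dart := G.other * swap d₁ (G.other d₂) * swap d₂ (G.other d₁)
  have o1 : o d₁ = d₂ := by
    simp only [o, Perm.mul_apply]
    rw [swap_apply_of_ne_of_ne hd hd1, swap_apply_left, G.other_other]
  have o2 : o d₂ = d₁ := by
    simp only [o, Perm.mul_apply]
    rw [swap_apply_left, swap_apply_of_ne_of_ne hd1.symm hc, G.other_other]
  have o3 : o (G.other d₁) = G.other d₂ := by
    simp only [o, Perm.mul_apply]
    rw [swap_apply_right, swap_apply_of_ne_of_ne hd.symm hd2]
  have o4 : o (G.other d₂) = G.other d₁ := by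
    simp only [o, Perm.mul_apply]
    rw [swap_apply_of_ne_of_ne hd2.symm hc.symm, swap_apply_right]
  have o5 : ∀ d, d ≠ d₁ → d ≠ d₂ → d ≠ G.other d₁ → d ≠ G.other d₂ → o d = G.other d := by
    intro d a b c e
    simp only [o, Perm.mul_apply]
    rw [swap_apply_of_ne_of_ne b c, swap_apply_of_ne_of_ne a e]
  have hcases : ∀ P : G.Dart → Prop, P d₁ → P d₂ → P (G.other d₁) → P (G.other d₂) →
      (∀ d, d ≠ d₁ → d ≠ d₂ → d ≠ G.other d₁ → d ≠ G.other d₂ → P d) → ∀ d, P d := by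
    intro P a b c e f d
    by_cases p1 : d = d₁
    · rwa [p1]
    by_cases p2 : d = d₂
    · rwa [p2]
    by_cases p3 : d = G.other d₁
    · rwa [p3]
    by_cases p4 : d = G.other d₂
    · rwa [p4]
    exact f d p1 p2 p3 p4
  have ho : ∀ d, o (o d) = d := by
    refine hcases _ (by rw [o1, o2]) (by rw [o2, o1]) (by rw [o3, o4]) (by rw [o4, o3]) ?_
    intro d a b c e
    rw [o5 d a b c e, o5 _ ?_ ?_ ?_ ?_, G.other_other]
    · exact fun h => c (by rw [← h, G.other_other])
    · exact fun h => e (by rw [← h, G.other_other])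
    · exact fun h => a (G.other.injective h)
    · exact fun h => b (G.other.injective h)
  have hod : ∀ d, o d ≠ d := by
    refine hcases _ (by rw [o1]; exact hd.symm) (by rw [o2]; exact hd) (by rw [o3]; exact hc.symm)
      (by rw [o4]; exact hc) ?_
    intro d a b c e
    rw [o5 d a b c e]
    exact G.other_ne d
  have hsame : SameCycle G.faceNext d₁ (G.other d₂) := G.leftFace_eq_iff.1 h1
  have f1 := numCycles_mul_swap_of_sameCycle G.faceNext hd3 hsame
  -- By `leftFace_ne` the second face differs from the first, so it survives the first splitting and
  -- is split in turn.
  have f2 := numCycles_mul_swap_of_sameCycle (G.faceNext * swap d₁ (G.other d₂)) hne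
    (sameCycle_mul_swap_of_not_mem _ hsame (G.leftFace_eq_iff.1 h2.symm)
      (fun h => hL d₁ ((G.leftFace_eq_iff.2 h).symm.trans h2.symm)))
  have f3 : G.faceNext * swap d₁ (G.other d₂) * swap d₂ (G.other d₁) =
      G.next * G.bdryRot * o := by
    simp only [o, DiskMap.faceNext_eq, mul_assoc]
  have f4 := card_eq_two_mul_numCycles o ho hod
  have f5 := G.card_dart
  have f6 := G.isPlanarMap
  have f7 := totalCycles_le G.next G.bdryRot o
  have f8 : numOrbits G.next G.bdryRot o ≤ numOrbits G.next G.bdryRot G.other + 1 := by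
    let s := orbitSetoid G.next G.bdryRot o
    let t := s.glue d₁ (G.other d₁)
    have hg : t d₁ (G.other d₁) := s.glue_self _ _
    have hto : ∀ d, t d (o d) := fun d => Setoid.glue_of _ _ (orbitSetoid_trd _ _ _ d)
    refine numOrbits_le_succ_of_glue d₁ (G.other d₁)
      (fun a => Setoid.glue_of _ _ (orbitSetoid_fst _ _ _ a))
      (fun a => Setoid.glue_of _ _ (orbitSetoid_snd _ _ _ a)) ?_
    -- Relating the ends of the first edge also relates those of the second, by way of the two new
    -- edges.
    have e2 : t d₂ (G.other d₂) := by
      have a := hto d₂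
      have b := hto (G.other d₁)
      rw [o2] at a
      rw [o3] at b
      exact t.trans a (t.trans hg b)
    refine hcases (fun a => t a (G.other a)) hg e2 ?_ ?_ ?_
    · rw [G.other_other]; exact t.symm hg
    · rw [G.other_other]; exact t.symm e2
    · intro d a b c e
      rw [← o5 d a b c e]; exact hto d
  have horb := G.meetsBoundary.numOrbits_eq_one
  rw [f3] at f2
  unfold DiskMap.IsPlanarMap IsPlanarTriple at f6
  -- Two faces are gained while the number of edges is unchanged. The genus bound then requires
  -- another orbit, `f8` permits only one, and equality follows.
  have hP : IsPlanarTriple G.next G.bdryRot o ∧ numOrbits G.next G.bdryRot o ≠ 1 := by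
    unfold IsPlanarTriple
    unfold totalCycles at *
    rw [DiskMap.faceNext_eq] at f1 f2
    omega
  obtain ⟨hP, horb'⟩ := hP
  let H : DiskMap N := G.withOther o ho hod
  obtain ⟨R, hR, hRn, hRo, hRb⟩ : ∃ R : Set G.Dart, (¬ ∀ d, d ∈ R) ∧
      (∀ z, G.next z ∈ R ↔ z ∈ R) ∧ (∀ z, o z ∈ R ↔ z ∈ R) ∧ ∀ i, G.bdry i ∈ R := by
    refine ⟨H.reach, fun h => ?_, H.next_mem_reach, H.other_mem_reach, H.bdry_mem_reach⟩
    have h3 : H.MeetsBoundary := fun S h1 h2 h3 d => h d S h1 h2 h3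
    exact horb' h3.numOrbits_eq_one
  have r1 : d₁ ∈ R ↔ d₂ ∈ R := by rw [← hRo d₁, o1]
  have r2 : G.other d₁ ∈ R ↔ G.other d₂ ∈ R := by rw [← hRo (G.other d₁), o3]
  have hiff : ¬ (G.other d₁ ∈ R ↔ d₁ ∈ R) := by
    intro h
    refine hR (G.meetsBoundary R hRb hRn ?_)
    refine hcases _ h (r2.symm.trans (h.trans r1)) ?_ ?_ ?_
    · rw [G.other_other]; exact h.symm
    · rw [G.other_other]; exact (r2.symm.trans (h.trans r1)).symm
    · intro d a b c e
      rw [← o5 d a b c e]; exact hRo d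
  have hIo : ∀ d ∉ R, d ≠ d₁ → d ≠ d₂ → d ≠ G.other d₁ → d ≠ G.other d₂ → G.other d ∉ R := by
    intro d hd a b c e
    rw [← o5 d a b c e, hRo]
    exact hd
  -- Exactly one side of the curve is cut off from the boundary. The cases differ by the exchange of
  -- each dart with its opposite.
  by_cases hdR : d₁ ∈ R
  · have hcR : G.other d₁ ∉ R := fun h => hiff ⟨fun _ => hdR, fun _ => h⟩
    refine hred.false_of_two_edge_cut htri hperm (I := Rᶜ) (fun i h => h (hRb i))
      (fun z => not_congr (hRn z)) hd (fun h => h hdR) (fun h => h (r1.1 hdR)) hcR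
      (fun h => hcR (r2.2 h)) ?_ o ho hod o1 o3 o5 hP
    exact fun d hd a b => hIo d hd (fun e => hd (e ▸ hdR)) (fun e => hd (e ▸ r1.1 hdR)) a b
  · have hcR : G.other d₁ ∈ R := by
      by_contra h
      exact hiff ⟨fun h' => absurd h' h, fun h' => absurd h' hdR⟩
    refine hred.false_of_two_edge_cut htri hperm (I := Rᶜ) (fun i h => h (hRb i))
      (fun z => not_congr (hRn z)) hc (fun h => h hcR) (fun h => h (r2.1 hcR)) ?_ ?_ ?_
      o ho hod o3 ?_ ?_ hP
    · rw [G.other_other]; exact hdR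
    · rw [G.other_other]; exact fun h => hdR (r1.2 h)
    · simp only [G.other_other]
      exact fun d hd a b => hIo d hd a b (fun e => hd (e ▸ hcR)) (fun e => hd (e ▸ r2.1 hcR))
    · simp only [G.other_other]; exact o1
    · simp only [G.other_other]
      exact fun d a b c e => o5 d c e a b

end PlabicGraph

/-! ### Bridges and tameness -/

namespace DiskMap

variable {N : ℕ}

open BridgeDart

/-- The face to the left of a dart after adding a bridge: a former face, or the new face between
the bridge and the boundary. -/
noncomputable def bridgeFace (G : DiskMap N) (h : ZMod N) :
    G.Dart ⊕ BridgeDart → G.Face ⊕ Unit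
  | Sum.inl d => Sum.inl (G.leftFace d)
  | Sum.inr bdL => Sum.inr ()
  | Sum.inr brL => Sum.inr ()
  | Sum.inr outR => Sum.inr ()
  | Sum.inr outL => Sum.inl (G.leftFace (G.bdry (h - 1)))
  | Sum.inr brR => Sum.inl (G.leftFace (G.bdry h))
  | Sum.inr bdR => Sum.inl (G.leftFace (G.bdry (h + 1)))

section AddBridge

variable (hN : 2 ≤ N) (G : DiskMap N) (h : ZMod N) (c : Bool)

theorem bridgeBdry_left : G.bridgeBdry h h = Sum.inr bdL := by simp [bridgeBdry]

theorem bridgeBdry_right (hN : 2 ≤ N) : G.bridgeBdry h (h + 1) = Sum.inr bdR := by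
  simp [bridgeBdry, succ_ne hN h]

theorem bridgeBdry_of_ne {i : ZMod N} (h1 : i ≠ h) (h2 : i ≠ h + 1) :
    G.bridgeBdry h i = Sum.inl (G.bdry i) := by simp [bridgeBdry, h1, h2]

theorem inr_notMem_range_bridgeBdry {b : BridgeDart} (h1 : b ≠ bdL) (h2 : b ≠ bdR) :
    (Sum.inr b : G.Dart ⊕ BridgeDart) ∉ Set.range (G.bridgeBdry h) := by
  rintro ⟨i, hi⟩
  unfold bridgeBdry at hi
  split_ifs at hi
  · exact h1 (Sum.inr.inj hi).symm
  · exact h2 (Sum.inr.inj hi).symm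

theorem inl_mem_range_bridgeBdry {d : G.Dart}
    (hd : (Sum.inl d : G.Dart ⊕ BridgeDart) ∈ Set.range (G.bridgeBdry h)) :
    d ∈ Set.range G.bdry ∧ d ≠ G.bdry h ∧ d ≠ G.bdry (h + 1) := by
  obtain ⟨i, hi⟩ := hd
  unfold bridgeBdry at hi
  split_ifs at hi with h1 h2
  have := Sum.inl.inj hi
  subst this
  exact ⟨⟨i, rfl⟩, by simpa using h1, by simpa using h2⟩

theorem bridgeFace_bdry {i : ZMod N} (hi : i ≠ h) :
    G.bridgeFace h (G.bridgeBdry h i) = Sum.inl (G.leftFace (G.bdry i)) := by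
  by_cases h2 : i = h + 1
  · subst h2
    simp [bridgeBdry, hi, bridgeFace]
  · rw [G.bridgeBdry_of_ne h hi h2]
    rfl

/-- The face walk is checked step by step, which makes `bridgeFace` an invariant of faces. No
converse is needed, since later arguments only draw consequences from a coincidence of faces. -/
theorem bridgeFace_faceNext (x : G.Dart ⊕ BridgeDart) :
    G.bridgeFace h ((G.addBridge hN h c).faceNext x) = G.bridgeFace h x := by
  let G' := G.addBridge hN h c
  have step : ∀ (x e : G.Dart ⊕ BridgeDart), G'.other x = e →
      e ∉ Set.range (G.bridgeBdry h) → G'.faceNext x = G.bridgeNext h e :=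
    fun x e hx he => G'.faceNext_of_eq hx he
  have stepb : ∀ (x : G.Dart ⊕ BridgeDart) (i : ZMod N), G'.other x = G.bridgeBdry h i →
      G'.faceNext x = G.bridgeBdry h (i - 1) := fun x i hx => G'.faceNext_of_bdry hx
  change G.bridgeFace h (G'.faceNext x) = _
  rcases x with d | b
  · by_cases hd : G.other d ∈ Set.range G.bdry
    · obtain ⟨i, hi⟩ := hd
      have ho : G'.other (Sum.inl d) = Sum.inl (G.bdry i) := congrArg Sum.inl hi.symm
      have hf : G.leftFace (G.bdry (i - 1)) = G.leftFace d := by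
        rw [← G.faceNext_of_bdry hi.symm, leftFace_faceNext]
      by_cases h1 : i = h
      · subst h1
        rw [step _ _ ho fun h' => (G.inl_mem_range_bridgeBdry i h').2.1 rfl,
          G.bridgeNext_left i hN]
        exact congrArg Sum.inl hf
      by_cases h2 : i = h + 1
      · subst h2
        rw [step _ _ ho fun h' => (G.inl_mem_range_bridgeBdry h h').2.2 rfl,
          G.bridgeNext_right h]
        rw [add_sub_cancel_right] at hf
        exact congrArg Sum.inl hf
      · rw [stepb _ i (ho.trans (G.bridgeBdry_of_ne h h1 h2).symm),
          G.bridgeFace_bdry h fun e => h2 (by rw [← e]; ring)]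
        exact congrArg Sum.inl hf
    · rw [step _ (Sum.inl (G.other d)) rfl fun h' => hd (G.inl_mem_range_bridgeBdry h h').1,
        G.bridgeNext_inl h (fun e => hd ⟨_, e.symm⟩) (fun e => hd ⟨_, e.symm⟩),
        ← G.faceNext_of_not_bdry hd]
      exact congrArg Sum.inl (mk_apply_eq G.faceNext d)
  · cases b
    · rw [step (Sum.inr bdL) (Sum.inr outL) rfl
        (G.inr_notMem_range_bridgeBdry h (by decide) (by decide)),
        G.bridgeNext_outL]
      rfl
    · rw [stepb (Sum.inr outL) h (G.bridgeBdry_left h).symm, G.bridgeFace_bdry]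
      · rfl
      · intro e
        exact succ_ne hN (h - 1) (by rw [sub_add_cancel]; exact e.symm)
    · rw [step (Sum.inr brL) (Sum.inr brR) rfl
        (G.inr_notMem_range_bridgeBdry h (by decide) (by decide)),
        G.bridgeNext_brR]
      rfl
    · rw [step (Sum.inr bdR) (Sum.inr outR) rfl
        (G.inr_notMem_range_bridgeBdry h (by decide) (by decide)),
        G.bridgeNext_outR h hN]
      rfl
    · rw [stepb (Sum.inr outR) (h + 1) (G.bridgeBdry_right h hN).symm, add_sub_cancel_right,
        G.bridgeBdry_left]
      rfl
    · rw [step (Sum.inr brR) (Sum.inr brL) rfl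
        (G.inr_notMem_range_bridgeBdry h (by decide) (by decide)),
        G.bridgeNext_brL]
      rfl

theorem bridgeFace_eq_of_leftFace_eq {x y : G.Dart ⊕ BridgeDart}
    (hxy : (G.addBridge hN h c).leftFace x = (G.addBridge hN h c).leftFace y) :
    G.bridgeFace h x = G.bridgeFace h y :=
  sameCycle_le_setoid (Setoid.ker (G.bridgeFace h))
    (fun x => (G.bridgeFace_faceNext hN h c x).symm) (Quotient.exact hxy)

end AddBridge

/-- Two darts have interior base points of different colours. -/
def OppositeBases (G : DiskMap N) (d e : G.Dart) : Prop :=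
  d ∉ Set.range G.bdry ∧ e ∉ Set.range G.bdry ∧ G.isBlack d ≠ G.isBlack e

/-- No edge has the same face on both sides, and if two edges lie between the same two faces, then
the end points on one of the two sides of a closed curve that crosses these edges have different
colours. -/
def IsTame (G : DiskMap N) : Prop :=
  (∀ d, G.leftFace d ≠ G.leftFace (G.other d)) ∧
  ∀ d e, e ≠ G.other d → G.leftFace d = G.leftFace (G.other e) →
    G.leftFace (G.other d) = G.leftFace e →
      G.OppositeBases d e ∨ G.OppositeBases (G.other d) (G.other e)

/-- Two opposite arrows are darts whose bases, on one side of the closed curve through the two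
faces, are both white, and whose far ends, on the other side, are both black. Neither side shows
different colours. -/
theorem IsTame.isSimple {G : DiskMap N} (hG : G.IsTame) : G.IsSimple := by
  refine ⟨fun F => ⟨fun d => hG.1 d.1 (d.2.2.2.2.trans d.2.2.2.1.symm)⟩, ?_⟩
  rintro F F' ⟨d, hd1, hd2, hd3, hd4⟩
  refine ⟨?_⟩
  rintro ⟨e, he1, he2, he3, he4⟩
  have hne : e ≠ G.other d := by
    rintro rfl
    rw [he1] at hd2
    exact absurd hd2 (by decide)
  rcases hG.2 d e hne (hd4.trans he3.symm) (hd3.trans he4.symm) with h | h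
  · exact h.2.2 (hd1.trans he1.symm)
  · exact h.2.2 (hd2.trans he2.symm)

/-- A bridge assigns new colours only to former darts based at boundary vertices. This is why
`OppositeBases` demands interior base points. -/
theorem OppositeBases.addBridge (hN : 2 ≤ N) {G : DiskMap N} (h : ZMod N) (c : Bool)
    {d e : G.Dart} (hde : G.OppositeBases d e) :
    (G.addBridge hN h c).OppositeBases (Sum.inl d) (Sum.inl e) := by
  obtain ⟨h1, h2, h3⟩ := hde
  refine ⟨fun h' => h1 (G.inl_mem_range_bridgeBdry h h').1,
    fun h' => h2 (G.inl_mem_range_bridgeBdry h h').1, fun h' => h3 ?_⟩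
  have key : ∀ d : G.Dart, d ∉ Set.range G.bdry →
      G.bridgeBlack h c (Sum.inl d) = G.isBlack d := by
    intro d hd
    have a1 : d ≠ G.bdry h := fun e => hd ⟨_, e.symm⟩
    have a2 : d ≠ G.bdry (h + 1) := fun e => hd ⟨_, e.symm⟩
    simp [bridgeBlack, a1, a2]
  rw [← key d h1, ← key e h2]
  exact h'

theorem oppositeBases_out (hN : 2 ≤ N) (G : DiskMap N) (h : ZMod N) (c : Bool) :
    (G.addBridge hN h c).OppositeBases (Sum.inr outL) (Sum.inr outR) := by
  refine ⟨G.inr_notMem_range_bridgeBdry h (by decide) (by decide),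
    G.inr_notMem_range_bridgeBdry h (by decide) (by decide), ?_⟩
  change c ≠ !c
  cases c <;> decide

theorem OppositeBases.symm {G : DiskMap N} {d e : G.Dart} (h : G.OppositeBases d e) :
    G.OppositeBases e d := ⟨h.2.1, h.1, h.2.2.symm⟩

/-- The face walk that arrives at the boundary vertex `i` continues along the boundary arc to `i -
1`. -/
theorem leftFace_other_bdry (G : DiskMap N) (i : ZMod N) :
    G.leftFace (G.other (G.bdry i)) = G.leftFace (G.bdry (i - 1)) := by
  rw [← G.faceNext_of_bdry (G.other_other (G.bdry i)), leftFace_faceNext]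

/-- Adding a bridge preserves tameness. -/
theorem IsTame.addBridge (hN : 2 ≤ N) {G : DiskMap N} (hG : G.IsTame) (h : ZMod N) (c : Bool) :
    (G.addBridge hN h c).IsTame := by
  -- Consecutive boundary arcs lie on the two sides of the edge between them, hence on different
  -- faces.
  have hb : ∀ i, G.leftFace (G.bdry i) ≠ G.leftFace (G.bdry (i - 1)) := by
    intro i
    rw [← G.leftFace_other_bdry]
    exact hG.1 _
  have hb1 := hb h
  have hb2 := hb (h + 1)
  rw [add_sub_cancel_right] at hb2
  have hout := oppositeBases_out hN G h c
  refine ⟨?_, ?_⟩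
  · rintro (d | d) hd
    · exact hG.1 d (Sum.inl.inj (G.bridgeFace_eq_of_leftFace_eq hN h c hd))
    · have := G.bridgeFace_eq_of_leftFace_eq hN h c hd
      cases d <;> cases this
  · rintro (d | d) (e | e) hne h1 h2
    · have e1 := Sum.inl.inj (G.bridgeFace_eq_of_leftFace_eq hN h c h1)
      have e2 := Sum.inl.inj (G.bridgeFace_eq_of_leftFace_eq hN h c h2)
      rcases hG.2 d e (fun h' => hne (congrArg Sum.inl h')) e1 e2 with h3 | h3
      · exact Or.inl (h3.addBridge hN h c)
      · exact Or.inr (h3.addBridge hN h c)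
    · have e1 := G.bridgeFace_eq_of_leftFace_eq hN h c h1
      have e2 := G.bridgeFace_eq_of_leftFace_eq hN h c h2
      -- A former edge does not border on the new face, while each new edge does.
      exfalso
      cases e <;> first | cases e1 | cases e2
    · have e1 := G.bridgeFace_eq_of_leftFace_eq hN h c h1
      have e2 := G.bridgeFace_eq_of_leftFace_eq hN h c h2
      exfalso
      cases d <;> first | cases e1 | cases e2
    · have e1 := G.bridgeFace_eq_of_leftFace_eq hN h c h1
      have e2 := G.bridgeFace_eq_of_leftFace_eq hN h c h2
      -- The three new edges border on the new face and have the former faces at the arcs `h - 1`,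
      -- `h` and `h + 1` on their other sides. By `hb1` and `hb2` only the first and the last of
      -- these can agree, and then the two ends of the bridge supply the opposite colours.
      cases d <;> cases e <;> first
        | exact absurd rfl hne
        | exact Or.inr hout
        | exact Or.inr hout.symm
        | exact Or.inl hout
        | exact Or.inl hout.symm
        | exact absurd (Sum.inl.inj e1) hb1
        | exact absurd (Sum.inl.inj e1) hb1.symm
        | exact absurd (Sum.inl.inj e2) hb1
        | exact absurd (Sum.inl.inj e2) hb1.symm
        | exact absurd (Sum.inl.inj e1) hb2
        | exact absurd (Sum.inl.inj e1) hb2.symm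
        | exact absurd (Sum.inl.inj e2) hb2
        | exact absurd (Sum.inl.inj e2) hb2.symm
        | cases e1

end DiskMap

theorem PlabicGraph.IsTame.affineFence {N : ℕ} (hN : 2 ≤ N) {G : PlabicGraph N} (hG : G.IsTame)
    (w : List (PlabicGraph.BraidLetter N)) : (G.affineFence hN w).IsTame := by
  induction w with
  | nil => exact hG
  | cons i w ih => exact ih.addBridge hN _ _

end

theorem mainTheorem8 (N : ℕ) (hN : 2 ≤ N) (π : Equiv.Perm (ZMod N)) (hπ : ∀ i, π i ≠ i)
    (G : PlabicGraph N) (hred : G.IsReduced) (htri : G.IsTrivalent) (hperm : G.HasStrandPerm π)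
    (w : List (PlabicGraph.BraidLetter N)) :
    (G.affineFence hN w).IsSimple := by
  have : NeZero N := ⟨by omega⟩
  refine DiskMap.IsTame.isSimple (PlabicGraph.IsTame.affineFence hN ?_ w)
  exact ⟨hred.leftFace_ne htri hperm,
    -- In the base graph no two edges share both faces, so the colour condition is vacuous.
    fun d e hne h1 h2 => absurd (hred.eq_other_of_leftFace_eq htri hperm h1 h2) hne⟩
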